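/- Let $\mathcal G$ be a finite nonempty directed graph with (linearly ordered) state set $\mathcal V$ whose edges are labelled by symbols of $\{0,1\}$ (edges with the same end points are allowed if their labels differ). Assume that $\mathcal G$ is deterministic (the outgoing edges of each state have distinct labels) and primitive (for some $k\ge 1$ any two states are joined by a path of length $k$). Let $\mathcal S$ be the constrained system presented by $\mathcal G$, that is, the set of words read along paths of $\mathcal G$, and $\mathcal S_n$ its set of words of length $n$. Write $\log=\log_2$ and put $$\mathrm{Cap}(\mathcal S)=\limsup_{n\to\infty}\frac{\log|\mathcal S_n|}{n},\qquad T(n,d)=\sum_{\mathbf x\in\mathcal S_n}\big|\{\mathbf z\in\mathcal S_n: d_H(\mathbf x,\mathbf z)\le d-1\}\big|\quad(d\ge 1),\qquad T(n,0)=T(n,1),$$ $$R_{GV}(\delta)=2\,\mathrm{Cap}(\mathcal S)-\limsup_{n\to\infty}\frac{\log T(n,\lfloor\delta n\rfloor)}{n},\qquad \mathcal{GV}(\mathcal S)=\{(\delta,R_{GV}(\delta)):0\le\delta\le 1\}.$$ For $i,j,k,l\in\mathcal V$ and real $y$ let $T_{(i,j),(k,l)}(y)=\sum y^{d_H(\sigma_1,\sigma_2)}$,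 the sum being over all pairs of edges $i\xrightarrow{\sigma_1}k$, $j\xrightarrow{\sigma_2}l$. The reduced distance matrix $B(y)$ is indexed by the pairs $(i,j)$ with $i\le j$ and has the entries $B_{(i,j),(k,l)}(y)=T_{(i,j),(k,l)}(y)+T_{(i,j),(l,k)}(y)$ if $k<l$ and $B_{(i,j),(k,k)}(y)=T_{(i,j),(k,k)}(y)$. Let $\Lambda(y)$ be the dominant eigenvalue of $B(y)$ (the largest modulus of its complex eigenvalues). Then $\Lambda(y)>0$ for $0\le y\le 1$ and $\Lambda$ is differentiable at every $y\in(0,1]$. Define, with $\delta(0)=0$ and $0\log 0=0$, $$\delta(y)=\frac{y\Lambda'(y)}{\Lambda(y)},\qquad \rho_{GV}(y)=2\,\mathrm{Cap}(\mathcal S)+\delta(y)\log y-\log\Lambda(y)\qquad(0\le y\le 1),$$ and $\delta_{\max}=\delta(1)$. Then $$\mathcal{GV}(\mathcal S)=\{(\delta(y),\rho_{GV}(y)):y\in[0,1]\}\cup\{(\delta,0):\delta_{\max}\le\delta\le 1\}.$$ -/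

import Mathlib

open Filter Set

/-- A labelled graph on the finite state set `V` over the binary alphabet: a finite set of
directed edges `u → v` carrying one binary symbol `σ`, recorded as triples `(u, σ, v)`.
Edges with the same end points are allowed as long as their labels differ. -/
structure LabelledGraph (V : Type*) where
  edges : Finset (V × Bool × V)

namespace LabelledGraph

/-- For each state, the outgoing edges carry distinct labels. -/
def Deterministic {V : Type*} (G : LabelledGraph V) : Prop :=
  ∀ (u : V) (σ : Bool) (v w : V), (u, σ, v) ∈ G.edges → (u, σ, w) ∈ G.edges → v = w

variable {V : Type*} [Fintype V] [LinearOrder V]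

/-- The adjacency matrix: the number of edges from `u` to `v`. -/
def adjMatrix (G : LabelledGraph V) : Matrix V V ℝ :=
  fun u v => ∑ σ : Bool, if (u, σ, v) ∈ G.edges then 1 else 0

/-- The graph is primitive: for some `k ≥ 1` any two states are joined by a path of length `k`. -/
def Primitive (G : LabelledGraph V) : Prop :=
  G.adjMatrix.IsPrimitive

/-- The word `x` is obtained by reading off the labels of a path of the graph. -/
def Reads (G : LabelledGraph V) {n : ℕ} (x : Fin n → Bool) : Prop :=
  ∃ p : Fin (n + 1) → V, ∀ t : Fin n, (p t.castSucc, x t, p t.succ) ∈ G.edges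

open Classical in
/-- `S_n`: the words of length `n` in the constrained system presented by the graph. -/
noncomputable def words (G : LabelledGraph V) (n : ℕ) : Finset (Fin n → Bool) :=
  Finset.univ.filter fun x => G.Reads x

/-- The capacity `limsup (log₂ |S_n|) / n`. -/
noncomputable def capacity (G : LabelledGraph V) : ℝ :=
  limsup (fun n : ℕ => Real.logb 2 ((G.words n).card : ℝ) / n) atTop

/-- `V(x, r)`: the number of words of the system in the Hamming ball of radius `r` around `x`. -/
noncomputable def ballVolume (G : LabelledGraph V) {n : ℕ} (x : Fin n → Bool) (r : ℕ) : ℕ :=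
  ((G.words n).filter fun z => hammingDist x z ≤ r).card

/-- `T(n, d)`: the sum over all words `x ∈ S_n` of `V(x, d - 1)`. Distances are meant to be
at least one: by truncated subtraction, `d = 0` is treated as `d = 1`. -/
noncomputable def totalBallSize (G : LabelledGraph V) (n d : ℕ) : ℕ :=
  ∑ x ∈ G.words n, G.ballVolume x (d - 1)

/-- The exponential growth rate of `T(n, ⌊δ n⌋)`. -/
noncomputable def ballRate (G : LabelledGraph V) (δ : ℝ) : ℝ :=
  limsup (fun n : ℕ => Real.logb 2 (G.totalBallSize n ⌊δ * n⌋₊ : ℝ) / n) atTop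

/-- The Gilbert-Varshamov rate `R_GV(δ)`. -/
noncomputable def gvRate (G : LabelledGraph V) (δ : ℝ) : ℝ :=
  2 * G.capacity - G.ballRate δ

/-- The GV curve: all points `(δ, R_GV(δ))` with `0 ≤ δ ≤ 1`. -/
noncomputable def gvCurve (G : LabelledGraph V) : Set (ℝ × ℝ) :=
  (fun δ : ℝ => (δ, G.gvRate δ)) '' Icc 0 1

/-- The distance label of an edge of the product graph that carries the symbols `σ₁, σ₂`. -/
def labelDist (σ₁ σ₂ : Bool) : ℕ := if σ₁ = σ₂ then 0 else 1

/-- The distance matrix of the product graph: each product edge `(i, j) → (k, l)`, given by edges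
`i → k` and `j → l` with labels `σ₁` and `σ₂`, contributes `y ^ D`, where `D` is the Hamming
distance of `σ₁` and `σ₂`. -/
def distMatrix (G : LabelledGraph V) (y : ℝ) : Matrix (V × V) (V × V) ℝ :=
  fun a b => ∑ σ₁ : Bool, ∑ σ₂ : Bool,
    if (a.1, σ₁, b.1) ∈ G.edges ∧ (a.2, σ₂, b.2) ∈ G.edges then y ^ labelDist σ₁ σ₂ else 0

/-- The reduced distance matrix, on the pairs `(i, j)` with `i ≤ j`: in the distance matrix the
column of `(l, k)` is added to the column of `(k, l)` for `k < l`, and then the row and the column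
of `(l, k)` are removed. -/
def reducedDistMatrix (G : LabelledGraph V) (y : ℝ) :
    Matrix {p : V × V // p.1 ≤ p.2} {p : V × V // p.1 ≤ p.2} ℝ :=
  fun a b => G.distMatrix y a.1 b.1 +
    if b.1.1 = b.1.2 then 0 else G.distMatrix y a.1 b.1.swap

end LabelledGraph

/-- The dominant eigenvalue: the largest modulus of a complex eigenvalue. (For a matrix with
nonnegative entries this number is itself an eigenvalue, hence also the largest real one.) -/
noncomputable def dominantEigenvalue {n : Type*} [Fintype n] [DecidableEq n]
    (M : Matrix n n ℝ) : ℝ :=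
  (spectralRadius ℂ (M.map (algebraMap ℝ ℂ))).toReal

namespace LabelledGraph

variable {V : Type*} [Fintype V] [LinearOrder V]

/-- `Λ(y)`: the dominant eigenvalue of the reduced distance matrix. -/
noncomputable def domEig (G : LabelledGraph V) (y : ℝ) : ℝ :=
  dominantEigenvalue (G.reducedDistMatrix y)

/-- `δ(y) = y Λ'(y) / Λ(y)`; in particular `δ(0) = 0`. -/
noncomputable def deltaFun (G : LabelledGraph V) (y : ℝ) : ℝ :=
  y * deriv G.domEig y / G.domEig y

/-- `δ_max = δ(1)`. -/
noncomputable def deltaMax (G : LabelledGraph V) : ℝ := G.deltaFun 1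

/-- `ρ_GV(y) = 2 Cap + δ(y) log₂ y - log₂ Λ(y)`; at `y = 0` the middle term is `0`. -/
noncomputable def rhoGV (G : LabelledGraph V) (y : ℝ) : ℝ :=
  2 * G.capacity + G.deltaFun y * Real.logb 2 y - Real.logb 2 (G.domEig y)

end LabelledGraph

/-!
The distance enumerator `∑ y ^ d(x, z)` over pairs of words `x, z ∈ S_n` is, up to bounded factors,
the sum over pairs of paths, because by determinism each word is read along at most one path from
each state (`exists_distEnumerator_bounds`). The latter sum is given by the `n`-th power of the
distance matrix `T(y) = T(0) + y D`, which is primitive for `y > 0`. Its Perron eigenvector is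
unique, hence invariant under exchanging the two coordinates, so it restricts to a positive
eigenvector of the reduced matrix and `Λ(y)` is the Perron eigenvalue of `T(y)`
(`Primitive.exists_right_eigenvector`). Thus `F(t) = log Λ(eᵗ)` is the limiting cumulant generating
function of the Hamming distance of a random pair of words.

The number `T(n, ⌊δ n⌋)` of pairs at distance less than `⌊δ n⌋` is then governed by the
one-dimensional Gärtner-Ellis theorem: Chernoff's bound from above, and the largest term of the
enumerator, which sits near distance `n F'(t)`, from below (`HasCumulantRate.tendsto_rate`,
`HasCumulantRate.tendsto_rate_of_lt`). Two properties of `F` enter.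
* It is differentiable: comparing the left eigenvector `v` at `y` with the right eigenvector
  `u(z)` at `z` gives `(Λ(z) - Λ(y)) / (z - y) = v D u(z) / v u(z)`, and `u(z) → u(y)` by compactness
  and uniqueness (`Primitive.hasDerivAt_domEig`). This yields `F'(log y) = δ(y) ∈ [0, 1]`.
* It is convex: geometric means of eigenvectors are supersolutions (`Primitive.convexOn_logEig`).

As `F` is bounded below by `log Λ(0)`, its derivative is arbitrarily small far to the left, so by
Darboux's theorem `δ` takes all values between `0` and `δ_max` on `[0, 1]`. At `y = 0` the matrix
`T(0)` need not be primitive, but there `Λ(0)` is the Perron eigenvalue of the adjacency matrix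
(`domEig_zero_eq`), whose logarithm is the capacity, while `Λ(1) = Λ(0) ^ 2`. If `D = 0` then `Λ` is
constant, hence equal to one, and the curve is trivial.
-/

/-! ### Perron's theorem for primitive matrices -/

namespace Matrix

variable {n : Type*} [Fintype n]

lemma mulVec_apply_pos {P : Matrix n n ℝ} (hP : ∀ i j, 0 < P i j) {w : n → ℝ}
    (hw : ∀ i, 0 ≤ w i) (hw0 : w ≠ 0) (i : n) : 0 < (P *ᵥ w) i := by
  obtain ⟨j, hj⟩ := Function.ne_iff.1 hw0
  have hj' : 0 < w j := lt_of_le_of_ne (hw j) (Ne.symm hj)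
  exact Finset.sum_pos' (fun k _ => mul_nonneg (hP i k).le (hw k))
    ⟨j, Finset.mem_univ _, mul_pos (hP i j) hj'⟩

lemma mulVec_mono {M : Matrix n n ℝ} (hM : ∀ i j, 0 ≤ M i j) {v w : n → ℝ}
    (h : ∀ i, v i ≤ w i) (i : n) : (M *ᵥ v) i ≤ (M *ᵥ w) i :=
  Finset.sum_le_sum fun j _ => mul_le_mul_of_nonneg_left (h j) (hM i j)

variable [DecidableEq n]

lemma pow_mulVec_of_mulVec_eq_smul {M : Matrix n n ℝ} {u : n → ℝ} {r : ℝ} (h : M *ᵥ u = r • u)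
    (k : ℕ) : (M ^ k) *ᵥ u = r ^ k • u := by
  induction k with
  | zero => simp
  | succ k ih => rw [pow_succ, ← mulVec_mulVec, h, mulVec_smul, ih, smul_smul, pow_succ, mul_comm]

lemma IsPrimitive.nonneg_eigenvector_pos {M : Matrix n n ℝ} (hM : M.IsPrimitive) {u : n → ℝ}
    {r : ℝ} (h : M *ᵥ u = r • u) (hu : ∀ i, 0 ≤ u i) (hu0 : u ≠ 0) (i : n) : 0 < u i := by
  obtain ⟨k, _, hpos⟩ := hM.exists_pos_pow
  have h1 := mulVec_apply_pos hpos hu hu0 i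
  rw [pow_mulVec_of_mulVec_eq_smul h] at h1
  refine lt_of_le_of_ne (hu i) fun h0 => ?_
  simp [← h0] at h1

/-- Perron's theorem, existence. The pairs `(x, r)` of a probability vector `x` and a number
`r ≥ 0` with `r x ≤ M x` form a compact set. If `r` is largest possible then `M x = r x`:
otherwise applying the positive matrix `M ^ k` makes the inequality strict in every coordinate,
leaving room for a larger `r`. -/
theorem IsPrimitive.exists_pos_eigenvector [Nonempty n] {M : Matrix n n ℝ} (hM : M.IsPrimitive) :
    ∃ r : ℝ, 0 < r ∧ ∃ u : n → ℝ, (∀ i, 0 < u i) ∧ ∑ i, u i = 1 ∧ M *ᵥ u = r • u := by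
  obtain ⟨k, hk, hpos⟩ := hM.exists_pos_pow
  set R : ℝ := ∑ i, ∑ j, M i j
  let K : Set ((n → ℝ) × ℝ) := {p | p ∈ stdSimplex ℝ n ×ˢ Icc 0 R ∧ ∀ i, p.2 * p.1 i ≤ (M *ᵥ p.1) i}
  have hcl : IsClosed {p : (n → ℝ) × ℝ | ∀ i, p.2 * p.1 i ≤ (M *ᵥ p.1) i} := by
    simp only [ofPred_forall]
    refine isClosed_iInter fun i => isClosed_le (by fun_prop) ?_
    simp only [mulVec, dotProduct]
    fun_prop
  have hK : IsCompact K :=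
    ((isCompact_stdSimplex ℝ n).prod isCompact_Icc).inter_right hcl
  have hR : 0 ≤ R := Finset.sum_nonneg fun i _ => Finset.sum_nonneg fun j _ => hM.nonneg i j
  have hne : K.Nonempty := by
    obtain ⟨i0⟩ := ‹Nonempty n›
    refine ⟨(Pi.single i0 1, 0), ⟨single_mem_stdSimplex ℝ i0, ⟨le_rfl, hR⟩⟩, fun i => ?_⟩
    simpa using hM.nonneg i i0
  obtain ⟨⟨x, r⟩, ⟨⟨hx, hr⟩, hxr⟩, hmax⟩ := hK.exists_isMaxOn hne continuous_snd.continuousOn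
  have hmax' : ∀ z : n → ℝ, ∀ r' : ℝ, z ∈ stdSimplex ℝ n → 0 ≤ r' →
      (∀ i, r' * z i ≤ (M *ᵥ z) i) → r' ≤ r := by
    intro z r' hz hr' h
    have hz1 : ∀ i, z i ≤ 1 := fun i => by
      rw [← hz.2]; exact Finset.single_le_sum (fun j _ => hz.1 j) (Finset.mem_univ i)
    have : r' ≤ R := by
      calc r' = ∑ i, r' * z i := by rw [← Finset.mul_sum, hz.2, mul_one]
        _ ≤ ∑ i, (M *ᵥ z) i := Finset.sum_le_sum fun i _ => h i
        _ ≤ R := Finset.sum_le_sum fun i _ => Finset.sum_le_sum fun j _ =>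
            mul_le_of_le_one_right (hM.nonneg i j) (hz1 j)
    exact hmax (show (z, r') ∈ K from ⟨⟨hz, hr', this⟩, h⟩)
  have hx0 : x ≠ 0 := by rintro rfl; simpa using hx.2
  have heq : M *ᵥ x = r • x := by
    by_contra hcon
    set w := M *ᵥ x - r • x with hw
    have hw0 : w ≠ 0 := sub_ne_zero.2 hcon
    have hwn : ∀ i, 0 ≤ w i := fun i => by simpa [hw] using hxr i
    set z := (M ^ k) *ᵥ x with hz
    have hzpos : ∀ i, 0 < z i := mulVec_apply_pos hpos hx.1 hx0
    have hlt : ∀ i, r * z i < (M *ᵥ z) i := fun i => by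
      have h1 := mulVec_apply_pos hpos hwn hw0 i
      rw [hw, mulVec_sub, mulVec_smul, mulVec_mulVec, ← pow_succ, pow_succ', ← mulVec_mulVec] at h1
      simp only [Pi.sub_apply, Pi.smul_apply, smul_eq_mul, sub_pos] at h1
      exact h1
    obtain ⟨i0, -, hi0⟩ := Finset.exists_min_image Finset.univ (fun i => (M *ᵥ z) i / z i)
      Finset.univ_nonempty
    set r' := (M *ᵥ z) i0 / z i0
    have hr' : r < r' := (lt_div_iff₀ (hzpos i0)).2 (hlt i0)
    have hs : 0 < ∑ i, z i := Finset.sum_pos (fun i _ => hzpos i) Finset.univ_nonempty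
    refine absurd (hmax' ((∑ i, z i)⁻¹ • z) r' ⟨fun i => ?_, ?_⟩ (hr.1.trans hr'.le) fun i => ?_)
      (not_le.2 hr')
    · exact mul_nonneg (inv_nonneg.2 hs.le) (hzpos i).le
    · simp only [Pi.smul_apply, smul_eq_mul, ← Finset.mul_sum]
      exact inv_mul_cancel₀ hs.ne'
    · rw [mulVec_smul]
      simp only [Pi.smul_apply, smul_eq_mul]
      rw [mul_left_comm]
      exact mul_le_mul_of_nonneg_left ((le_div_iff₀ (hzpos i)).1 (hi0 i (Finset.mem_univ i)))
        (inv_nonneg.2 hs.le)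
  have hxpos := hM.nonneg_eigenvector_pos heq hx.1 hx0
  refine ⟨r, ?_, x, hxpos, hx.2, heq⟩
  refine lt_of_le_of_ne hr.1 fun h0 => ?_
  obtain ⟨i0⟩ := ‹Nonempty n›
  have h1 := mulVec_apply_pos hpos hx.1 hx0 i0
  rw [pow_mulVec_of_mulVec_eq_smul heq] at h1
  simp [← h0, zero_pow hk.ne'] at h1

/-- Perron's theorem, uniqueness: subtracting from `w` the largest multiple of `u` below it leaves
a nonnegative eigenvector with a zero coordinate, which has to vanish. -/
theorem IsPrimitive.eigenvector_unique [Nonempty n] {M : Matrix n n ℝ} (hM : M.IsPrimitive) {r : ℝ}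
    {u w : n → ℝ} (hu : ∀ i, 0 < u i) (hu1 : ∑ i, u i = 1) (hMu : M *ᵥ u = r • u)
    (hw1 : ∑ i, w i = 1) (hMw : M *ᵥ w = r • w) : w = u := by
  obtain ⟨i0, -, hi0⟩ := Finset.exists_min_image Finset.univ (fun i => w i / u i)
    Finset.univ_nonempty
  set c := w i0 / u i0 with hc
  have hh : M *ᵥ (w - c • u) = r • (w - c • u) := by
    rw [mulVec_sub, mulVec_smul, hMu, hMw, smul_sub, smul_comm]
  have hzero : w - c • u = 0 := by
    by_contra h0
    have h1 := hM.nonneg_eigenvector_pos hh (fun i => ?_) h0 i0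
    · simp [hc, (hu i0).ne'] at h1
    · have := (le_div_iff₀ (hu i)).1 (hi0 i (Finset.mem_univ i))
      simpa using this
  have hwu : w = c • u := sub_eq_zero.1 hzero
  have hc1 : c = 1 := by
    rw [hwu] at hw1
    simpa [← Finset.mul_sum, hu1] using hw1
  rw [hwu, hc1, one_smul]

lemma IsPrimitive.transpose {M : Matrix n n ℝ} (hM : M.IsPrimitive) : Mᵀ.IsPrimitive := by
  obtain ⟨k, hk, hpos⟩ := hM.exists_pos_pow
  exact ⟨fun i j => hM.nonneg j i, k, hk, fun i j => by rw [← transpose_pow]; exact hpos j i⟩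

/-- The left Perron eigenvector belongs to the same eigenvalue as the right one. -/
theorem IsPrimitive.exists_pos_left_eigenvector [Nonempty n] {M : Matrix n n ℝ}
    (hM : M.IsPrimitive) {r : ℝ} {u : n → ℝ} (hu : ∀ i, 0 < u i) (hMu : M *ᵥ u = r • u) :
    ∃ v : n → ℝ, (∀ i, 0 < v i) ∧ v ᵥ* M = r • v := by
  obtain ⟨s, -, v, hv, -, hMv⟩ := hM.transpose.exists_pos_eigenvector
  rw [mulVec_transpose] at hMv
  refine ⟨v, hv, ?_⟩
  have h1 : v ⬝ᵥ M *ᵥ u = (v ᵥ* M) ⬝ᵥ u := dotProduct_mulVec v M u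
  rw [hMu, hMv, dotProduct_smul, smul_dotProduct] at h1
  have h2 : 0 < v ⬝ᵥ u := Finset.sum_pos (fun i _ => mul_pos (hv i) (hu i)) Finset.univ_nonempty
  rw [hMv, mul_right_cancel₀ h2.ne' h1]

lemma pow_mulVec_mono {M : Matrix n n ℝ} (hM : ∀ i j, 0 ≤ M i j) {v w : n → ℝ}
    (h : ∀ i, v i ≤ w i) (k : ℕ) (i : n) : ((M ^ k) *ᵥ v) i ≤ ((M ^ k) *ᵥ w) i := by
  induction k generalizing i with
  | zero => simpa using h i
  | succ k ih =>
    rw [pow_succ', ← mulVec_mulVec, ← mulVec_mulVec]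
    exact mulVec_mono hM ih i

/-- The row sums of the powers of a nonnegative matrix with a positive eigenvector grow like the
powers of the eigenvalue, up to constant factors. -/
theorem exists_rowSum_pow_bounds [Nonempty n] {M : Matrix n n ℝ} (hM : ∀ i j, 0 ≤ M i j) {r : ℝ}
    (hr : 0 < r) {u : n → ℝ} (hu : ∀ i, 0 < u i) (hMu : M *ᵥ u = r • u) :
    ∃ c > 0, ∃ C > 0, ∀ (k : ℕ) (i : n),
      c * r ^ k ≤ ((M ^ k) *ᵥ 1) i ∧ ((M ^ k) *ᵥ 1) i ≤ C * r ^ k := by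
  obtain ⟨i1, -, h1⟩ := Finset.exists_min_image Finset.univ u Finset.univ_nonempty
  obtain ⟨i2, -, h2⟩ := Finset.exists_max_image Finset.univ u Finset.univ_nonempty
  have hm : ∀ i, u i1 ≤ u i := fun i => h1 i (Finset.mem_univ i)
  have hM' : ∀ i, u i ≤ u i2 := fun i => h2 i (Finset.mem_univ i)
  have key : ∀ (k : ℕ) (a : ℝ) (i : n), ((M ^ k) *ᵥ (a • u)) i = a * (r ^ k * u i) := by
    intro k a i
    rw [mulVec_smul, pow_mulVec_of_mulVec_eq_smul hMu]; rfl
  refine ⟨u i1 / u i2, div_pos (hu _) (hu _), u i2 / u i1, div_pos (hu _) (hu _), fun k i => ?_⟩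
  have hrk : 0 < r ^ k := pow_pos hr k
  constructor
  · calc u i1 / u i2 * r ^ k = (u i2)⁻¹ * (r ^ k * u i1) := by rw [div_eq_mul_inv]; ring
      _ ≤ (u i2)⁻¹ * (r ^ k * u i) := by
          have := hm i; have := (inv_pos.2 (hu i2)).le; gcongr
      _ = ((M ^ k) *ᵥ ((u i2)⁻¹ • u)) i := (key ..).symm
      _ ≤ _ := pow_mulVec_mono hM (fun j => by
          simpa [inv_mul_eq_div] using (div_le_one (hu i2)).2 (hM' j)) k i
  · calc ((M ^ k) *ᵥ 1) i ≤ ((M ^ k) *ᵥ ((u i1)⁻¹ • u)) i := pow_mulVec_mono hM (fun j => by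
          simpa [inv_mul_eq_div] using (one_le_div (hu i1)).2 (hm j)) k i
      _ = (u i1)⁻¹ * (r ^ k * u i) := key ..
      _ ≤ (u i1)⁻¹ * (r ^ k * u i2) := by
          have := hM' i; have := (inv_pos.2 (hu i1)).le; gcongr
      _ = u i2 / u i1 * r ^ k := by rw [div_eq_mul_inv]; ring

end Matrix

/-! ### The spectral radius of a nonnegative matrix -/

section DominantEigenvalue

open Matrix

variable {n : Type*} [Fintype n] [DecidableEq n]

lemma spectrum_norm_le_of_mulVec_le {M : Matrix n n ℝ} (hM : ∀ i j, 0 ≤ M i j) {r : ℝ}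
    {g : n → ℝ} (hg : ∀ i, 0 < g i) (h : ∀ i, (M *ᵥ g) i ≤ r * g i) {z : ℂ}
    (hz : z ∈ spectrum ℂ (M.map (algebraMap ℝ ℂ))) : ‖z‖ ≤ r := by
  set N := M.map (algebraMap ℝ ℂ) with hN
  have hdet : (algebraMap ℂ (Matrix n n ℂ) z - N).det = 0 := by
    have := spectrum.mem_iff.1 hz
    rwa [isUnit_iff_isUnit_det, isUnit_iff_ne_zero, not_not] at this
  obtain ⟨x, hx0, hx⟩ := exists_mulVec_eq_zero_iff.2 hdet
  have hx' : N *ᵥ x = z • x := by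
    rw [sub_mulVec, sub_eq_zero, Algebra.algebraMap_eq_smul_one, smul_mulVec, one_mulVec] at hx
    exact hx.symm
  obtain ⟨j, hj⟩ := Function.ne_iff.1 hx0
  obtain ⟨i, -, hi⟩ := Finset.exists_max_image Finset.univ (fun i => ‖x i‖ / g i) ⟨j, by simp⟩
  set m := ‖x i‖ / g i with hm
  have hmpos : 0 < m := lt_of_lt_of_le (div_pos (norm_pos_iff.2 hj) (hg j)) (hi j (by simp))
  have hxm : ∀ k, ‖x k‖ ≤ m * g k := fun k => (div_le_iff₀ (hg k)).1 (hi k (by simp))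
  have hxi : ‖x i‖ = m * g i := by rw [hm, div_mul_cancel₀ _ (hg i).ne']
  have h1 : ‖z‖ * (m * g i) ≤ r * (m * g i) := by
    calc ‖z‖ * (m * g i) = ‖(N *ᵥ x) i‖ := by rw [hx', ← hxi]; simp
      _ ≤ ∑ k, ‖N i k * x k‖ := norm_sum_le _ _
      _ ≤ ∑ k, M i k * (m * g k) := Finset.sum_le_sum fun k _ => by
          rw [norm_mul]
          have : ‖N i k‖ = M i k := by simp [hN, abs_of_nonneg (hM i k)]
          rw [this]
          exact mul_le_mul_of_nonneg_left (hxm k) (hM i k)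
      _ = m * (M *ᵥ g) i := by
          simp only [mulVec, dotProduct, Finset.mul_sum]
          exact Finset.sum_congr rfl fun k _ => by ring
      _ ≤ m * (r * g i) := mul_le_mul_of_nonneg_left (h i) hmpos.le
      _ = r * (m * g i) := by ring
  exact le_of_mul_le_mul_right h1 (mul_pos hmpos (hg i))

lemma mem_spectrum_of_mulVec_eq_smul {M : Matrix n n ℝ} {r : ℝ} {u : n → ℝ} (hu : u ≠ 0)
    (h : M *ᵥ u = r • u) : (r : ℂ) ∈ spectrum ℂ (M.map (algebraMap ℝ ℂ)) := by
  rw [spectrum.mem_iff, isUnit_iff_isUnit_det, isUnit_iff_ne_zero, not_not]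
  have h1 : (algebraMap ℂ (Matrix n n ℂ) (r : ℂ) - M.map (algebraMap ℝ ℂ))
      = (algebraMap ℝ (Matrix n n ℝ) r - M).map (algebraMap ℝ ℂ) := by
    ext i j
    simp only [Matrix.sub_apply, Matrix.map_apply, Matrix.algebraMap_matrix_apply, map_sub]
    split_ifs <;> simp
  rw [h1, ← RingHom.mapMatrix_apply, ← RingHom.map_det]
  have h2 : (algebraMap ℝ (Matrix n n ℝ) r - M).det = 0 :=
    exists_mulVec_eq_zero_iff.1 ⟨u, hu, by
      rw [sub_mulVec, h, Algebra.algebraMap_eq_smul_one, smul_mulVec, one_mulVec, sub_self]⟩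
  rw [h2, map_zero]

/-- The spectral radius of a nonnegative matrix with eigenvalue `r ≥ 0` is `r` as soon as some
positive vector `g` satisfies `M g ≤ r g`. -/
theorem dominantEigenvalue_eq {M : Matrix n n ℝ} (hM : ∀ i j, 0 ≤ M i j) {r : ℝ} (hr : 0 ≤ r)
    (hspec : (r : ℂ) ∈ spectrum ℂ (M.map (algebraMap ℝ ℂ))) {g : n → ℝ} (hg : ∀ i, 0 < g i)
    (h : ∀ i, (M *ᵥ g) i ≤ r * g i) : dominantEigenvalue M = r := by
  have h1 : spectralRadius ℂ (M.map (algebraMap ℝ ℂ)) = ENNReal.ofReal r := by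
    refine le_antisymm (iSup₂_le fun z hz => ?_) ?_
    · rw [← ENNReal.ofReal_coe_nnreal, coe_nnnorm]
      exact ENNReal.ofReal_le_ofReal (spectrum_norm_le_of_mulVec_le hM hg h hz)
    · refine le_trans ?_ (le_iSup₂ (f := fun z (_ : z ∈ spectrum ℂ (M.map (algebraMap ℝ ℂ))) =>
        (‖z‖₊ : ENNReal)) (r : ℂ) hspec)
      rw [← ENNReal.ofReal_coe_nnreal, coe_nnnorm]
      simp [abs_of_nonneg hr]
  rw [dominantEigenvalue, h1, ENNReal.toReal_ofReal hr]

lemma mem_spectrum_of_vecMul_eq_smul {M : Matrix n n ℝ} {r : ℝ} {v : n → ℝ} (hv : v ≠ 0)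
    (h : v ᵥ* M = r • v) : (r : ℂ) ∈ spectrum ℂ (M.map (algebraMap ℝ ℂ)) := by
  have h1 := mem_spectrum_of_mulVec_eq_smul (M := Mᵀ) hv (by rw [mulVec_transpose, h])
  rw [spectrum.mem_iff, isUnit_iff_isUnit_det] at h1 ⊢
  rwa [← det_transpose, transpose_sub, ← transpose_map, Algebra.algebraMap_eq_smul_one,
    transpose_smul, transpose_one, ← Algebra.algebraMap_eq_smul_one]

end DominantEigenvalue

/-! ### Primitivity under comparison and Kronecker products -/

namespace Matrix

variable {n : Type*} [Fintype n] [DecidableEq n]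

lemma pow_apply_le_pow_apply {A B : Matrix n n ℝ} (hA : ∀ i j, 0 ≤ A i j)
    (h : ∀ i j, A i j ≤ B i j) (k : ℕ) (i j : n) : 0 ≤ (A ^ k) i j ∧ (A ^ k) i j ≤ (B ^ k) i j := by
  induction k generalizing i j with
  | zero =>
    refine ⟨?_, le_rfl⟩
    rw [pow_zero, one_apply]
    split_ifs <;> norm_num
  | succ k ih =>
    simp only [pow_succ, mul_apply]
    exact ⟨Finset.sum_nonneg fun l _ => mul_nonneg (ih i l).1 (hA l j),
      Finset.sum_le_sum fun l _ => mul_le_mul (ih i l).2 (h l j) (hA l j)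
        ((ih i l).1.trans (ih i l).2)⟩

lemma IsPrimitive.mono {A B : Matrix n n ℝ} (hA : A.IsPrimitive) {c : ℝ} (hc : 0 < c)
    (h : ∀ i j, c * A i j ≤ B i j) : B.IsPrimitive := by
  obtain ⟨k, hk, hpos⟩ := hA.exists_pos_pow
  have h0 : ∀ i j, 0 ≤ (c • A) i j := fun i j => mul_nonneg hc.le (hA.nonneg i j)
  refine ⟨fun i j => (h0 i j).trans (h i j), k, hk, fun i j => ?_⟩
  refine lt_of_lt_of_le ?_ (pow_apply_le_pow_apply h0 h k i j).2
  rw [smul_pow]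
  exact mul_pos (pow_pos hc k) (hpos i j)

lemma kronecker_pow {m : Type*} [Fintype m] [DecidableEq m] (A : Matrix n n ℝ) (B : Matrix m m ℝ)
    (k : ℕ) : kroneckerMap (· * ·) A B ^ k = kroneckerMap (· * ·) (A ^ k) (B ^ k) := by
  induction k with
  | zero => simp only [pow_zero]; exact one_kronecker_one.symm
  | succ k ih => rw [pow_succ, ih, pow_succ, pow_succ]; exact (mul_kronecker_mul ..).symm

lemma IsPrimitive.kronecker {m : Type*} [Fintype m] [DecidableEq m] {A : Matrix n n ℝ}
    (hA : A.IsPrimitive) : (kroneckerMap (· * ·) A A).IsPrimitive := by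
  obtain ⟨k, hk, hpos⟩ := hA.exists_pos_pow
  refine ⟨fun i j => mul_nonneg (hA.nonneg _ _) (hA.nonneg _ _), k, hk, fun i j => ?_⟩
  rw [kronecker_pow]
  exact mul_pos (hpos _ _) (hpos _ _)

end Matrix

/-! ### The distance matrix and its Perron eigenvalue -/

namespace LabelledGraph

open Matrix

variable {V : Type*} [LinearOrder V]

/-- The indicator of the edge `u → v` with the label `σ`. -/
def edgeInd (G : LabelledGraph V) (u : V) (σ : Bool) (v : V) : ℝ :=
  if (u, σ, v) ∈ G.edges then 1 else 0

lemma edgeInd_nonneg (G : LabelledGraph V) (u : V) (σ : Bool) (v : V) : 0 ≤ G.edgeInd u σ v := by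
  unfold edgeInd; split_ifs <;> norm_num

lemma adjMatrix_apply (G : LabelledGraph V) (u v : V) :
    G.adjMatrix u v = ∑ σ, G.edgeInd u σ v := rfl

lemma distMatrix_apply (G : LabelledGraph V) (y : ℝ) (a b : V × V) :
    G.distMatrix y a b = ∑ σ₁, ∑ σ₂,
      G.edgeInd a.1 σ₁ b.1 * G.edgeInd a.2 σ₂ b.2 * y ^ labelDist σ₁ σ₂ := by
  refine Finset.sum_congr rfl fun σ₁ _ => Finset.sum_congr rfl fun σ₂ _ => ?_
  unfold edgeInd
  by_cases h1 : (a.1, σ₁, b.1) ∈ G.edges <;> by_cases h2 : (a.2, σ₂, b.2) ∈ G.edges <;>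
    simp [h1, h2]

/-- The number of product edges whose two labels differ: the coefficient matrix of `y` in the
distance matrix, whose constant term is `G.distMatrix 0`. -/
def differMatrix (G : LabelledGraph V) : Matrix (V × V) (V × V) ℝ :=
  fun a b => ∑ σ₁, ∑ σ₂,
    G.edgeInd a.1 σ₁ b.1 * G.edgeInd a.2 σ₂ b.2 * (labelDist σ₁ σ₂ : ℝ)

lemma differMatrix_nonneg (G : LabelledGraph V) (a b : V × V) : 0 ≤ G.differMatrix a b :=
  Finset.sum_nonneg fun _ _ => Finset.sum_nonneg fun _ _ =>
    mul_nonneg (mul_nonneg (G.edgeInd_nonneg ..) (G.edgeInd_nonneg ..)) (Nat.cast_nonneg _)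

lemma distMatrix_eq_add (G : LabelledGraph V) (y : ℝ) :
    G.distMatrix y = G.distMatrix 0 + y • G.differMatrix := by
  ext a b
  simp only [Matrix.add_apply, Matrix.smul_apply, distMatrix_apply, differMatrix, smul_eq_mul,
    Finset.mul_sum, ← Finset.sum_add_distrib]
  refine Finset.sum_congr rfl fun σ₁ _ => Finset.sum_congr rfl fun σ₂ _ => ?_
  by_cases h : σ₁ = σ₂ <;> simp [labelDist, h]
  ring

lemma distMatrix_nonneg (G : LabelledGraph V) {y : ℝ} (hy : 0 ≤ y) (a b : V × V) :
    0 ≤ G.distMatrix y a b := by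
  rw [distMatrix_apply]
  exact Finset.sum_nonneg fun _ _ => Finset.sum_nonneg fun _ _ =>
    mul_nonneg (mul_nonneg (G.edgeInd_nonneg ..) (G.edgeInd_nonneg ..)) (pow_nonneg hy _)

lemma distMatrix_one (G : LabelledGraph V) :
    G.distMatrix 1 = kroneckerMap (· * ·) G.adjMatrix G.adjMatrix := by
  ext a b
  simp only [distMatrix_apply, kroneckerMap_apply, adjMatrix_apply, one_pow, mul_one,
    Finset.sum_mul_sum]

lemma distMatrix_swap (G : LabelledGraph V) (y : ℝ) (a b : V × V) :
    G.distMatrix y a.swap b.swap = G.distMatrix y a b := by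
  rw [distMatrix_apply, distMatrix_apply, Finset.sum_comm]
  refine Finset.sum_congr rfl fun σ₁ _ => Finset.sum_congr rfl fun σ₂ _ => ?_
  have : labelDist σ₂ σ₁ = labelDist σ₁ σ₂ := by simp [labelDist, eq_comm]
  rw [this]
  simp only [Prod.fst_swap, Prod.snd_swap]
  ring

lemma distMatrix_zero_apply (G : LabelledGraph V) (a b : V × V) :
    G.distMatrix 0 a b = ∑ σ, G.edgeInd a.1 σ b.1 * G.edgeInd a.2 σ b.2 := by
  rw [distMatrix_apply]
  refine Finset.sum_congr rfl fun σ _ => ?_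
  rw [Finset.sum_eq_single σ]
  · simp [labelDist]
  · intro τ _ h
    simp [labelDist, Ne.symm h]
  · simp

lemma reducedDistMatrix_nonneg (G : LabelledGraph V) {y : ℝ} (hy : 0 ≤ y)
    (a b : {p : V × V // p.1 ≤ p.2}) : 0 ≤ G.reducedDistMatrix y a b := by
  unfold reducedDistMatrix
  have := G.distMatrix_nonneg hy
  split_ifs
  · simpa using this _ _
  · exact add_nonneg (this _ _) (this _ _)

/-- Two edges leaving the same state with the same label are equal, so the product graph restricted
to equal labels maps the diagonal to the diagonal, where it is the original graph. -/
lemma Deterministic.distMatrix_zero_diag {G : LabelledGraph V} (hG : G.Deterministic) (i : V)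
    (b : V × V) : G.distMatrix 0 (i, i) b = if b.1 = b.2 then G.adjMatrix i b.1 else 0 := by
  rw [distMatrix_zero_apply]
  split_ifs with h
  · rw [adjMatrix_apply, ← h]
    refine Finset.sum_congr rfl fun σ _ => ?_
    unfold edgeInd
    split_ifs <;> simp
  · refine Finset.sum_eq_zero fun σ _ => ?_
    unfold edgeInd
    split_ifs with h1 h2 <;> simp
    exact h (hG _ _ _ _ h1 h2)

variable [Fintype V]

lemma Primitive.distMatrix {G : LabelledGraph V} (hG : G.Primitive) {y : ℝ} (hy : 0 < y) :
    (G.distMatrix y).IsPrimitive := by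
  have h1 : (G.distMatrix 1).IsPrimitive := by
    rw [distMatrix_one]; exact IsPrimitive.kronecker (m := V) hG
  refine h1.mono (lt_min one_pos hy) fun a b => ?_
  have hC := G.distMatrix_nonneg le_rfl a b
  have hD := G.differMatrix_nonneg a b
  rw [distMatrix_eq_add G 1, distMatrix_eq_add G y]
  simp only [Matrix.add_apply, Matrix.smul_apply, smul_eq_mul, one_mul, mul_add]
  exact add_le_add (mul_le_of_le_one_left hC (min_le_left _ _))
    (mul_le_mul_of_nonneg_right (min_le_right _ _) hD)

lemma sum_subtype_le_add_swap (f : V × V → ℝ) :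
    ∑ p : {p : V × V // p.1 ≤ p.2}, (f p.1 + if p.1.1 = p.1.2 then 0 else f p.1.swap)
      = ∑ p, f p := by
  have h1 : ∑ p : {p : V × V // p.1 ≤ p.2}, (if p.1.1 = p.1.2 then 0 else f p.1.swap)
      = ∑ p : {p : V × V // ¬ p.1 ≤ p.2}, f p.1 := by
    symm
    refine Fintype.sum_of_injective
      (fun p : {p : V × V // ¬ p.1 ≤ p.2} =>
        (⟨p.1.swap, (not_le.1 p.2).le⟩ : {p : V × V // p.1 ≤ p.2})) ?_ _ _ ?_ ?_
    · intro p q h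
      simpa [Subtype.ext_iff] using h
    · rintro ⟨⟨i, j⟩, h⟩ hn
      by_cases hij : i = j
      · simp [hij]
      · exact absurd ⟨⟨(j, i), not_le.2 (lt_of_le_of_ne h hij)⟩, rfl⟩ hn
    · rintro ⟨⟨i, j⟩, h⟩
      have : j ≠ i := fun e => h e.ge
      simp [this]
  rw [Finset.sum_add_distrib, h1]
  exact Fintype.sum_subtype_add_sum_subtype (fun p : V × V => p.1 ≤ p.2) f

/-- The reduced distance matrix is the action of the distance matrix on the functions that are
symmetric under exchange of the two coordinates. -/
lemma reducedDistMatrix_mulVec (G : LabelledGraph V) (y : ℝ) {f : V × V → ℝ}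
    (hf : ∀ p, f p.swap = f p) (a : {p : V × V // p.1 ≤ p.2}) :
    (G.reducedDistMatrix y *ᵥ fun b => f b.1) a = (G.distMatrix y *ᵥ f) a.1 := by
  simp only [mulVec, dotProduct]
  rw [← sum_subtype_le_add_swap]
  refine Finset.sum_congr rfl fun b _ => ?_
  unfold reducedDistMatrix
  split_ifs
  · simp
  · rw [hf, add_mul]

/-- For `y > 0`, `Λ(y)` is also the Perron eigenvalue of the full distance matrix: the Perron
eigenvector is unique, hence symmetric, hence an eigenvector of the reduced matrix. -/
theorem Primitive.exists_right_eigenvector [Nonempty V] {G : LabelledGraph V} (hG : G.Primitive)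
    {y : ℝ} (hy : 0 < y) :
    0 < G.domEig y ∧ ∃ u : V × V → ℝ, (∀ a, 0 < u a) ∧ ∑ a, u a = 1 ∧
      G.distMatrix y *ᵥ u = G.domEig y • u := by
  obtain ⟨r, hr, u, hu, hu1, hMu⟩ := (hG.distMatrix hy).exists_pos_eigenvector
  have hsymm : ∀ p, u p.swap = u p := by
    have h1 : ∑ p : V × V, u p.swap = 1 := by
      rw [← hu1]
      exact (Equiv.prodComm V V).sum_comp u
    have h2 : G.distMatrix y *ᵥ (fun p : V × V => u p.swap) = r • fun p : V × V => u p.swap := by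
      ext a
      have h3 := congrFun hMu a.swap
      simp only [mulVec, dotProduct, Pi.smul_apply] at h3 ⊢
      rw [← h3, ← (Equiv.prodComm V V).sum_comp]
      refine Finset.sum_congr rfl fun b _ => ?_
      simp only [Equiv.prodComm_apply, Prod.swap_swap]
      rw [← distMatrix_swap G y a, Prod.swap_swap]
    exact congrFun ((hG.distMatrix hy).eigenvector_unique hu hu1 hMu h1 h2)
  have hB : G.reducedDistMatrix y *ᵥ (fun b => u b.1) = r • fun b => u b.1 := by
    ext a
    rw [reducedDistMatrix_mulVec G y hsymm, hMu]; rfl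
  obtain ⟨i⟩ := ‹Nonempty V›
  have hdom : G.domEig y = r :=
    dominantEigenvalue_eq (G.reducedDistMatrix_nonneg hy.le) hr.le
      (mem_spectrum_of_mulVec_eq_smul
        (fun h => (hu (i, i)).ne' (congrFun h ⟨(i, i), le_rfl⟩)) hB)
      (fun b => hu b.1) fun a => (congrFun hB a).le
  rw [hdom]
  exact ⟨hr, u, hu, hu1, hMu⟩

theorem Primitive.exists_left_eigenvector [Nonempty V] {G : LabelledGraph V} (hG : G.Primitive)
    {y : ℝ} (hy : 0 < y) :
    ∃ v : V × V → ℝ, (∀ a, 0 < v a) ∧ v ᵥ* G.distMatrix y = G.domEig y • v := by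
  obtain ⟨-, u, hu, -, hMu⟩ := hG.exists_right_eigenvector hy
  exact (hG.distMatrix hy).exists_pos_left_eigenvector hu hMu

lemma Primitive.domEig_pos [Nonempty V] {G : LabelledGraph V} (hG : G.Primitive)
    {y : ℝ} (hy : 0 < y) : 0 < G.domEig y := (hG.exists_right_eigenvector hy).1

/-- The upper half of the Collatz-Wielandt characterization of `Λ(y)`. -/
lemma Primitive.domEig_le [Nonempty V] {G : LabelledGraph V} (hG : G.Primitive)
    {y : ℝ} (hy : 0 < y) {g : V × V → ℝ} (hg : ∀ a, 0 < g a) {r : ℝ}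
    (h : ∀ a, (G.distMatrix y *ᵥ g) a ≤ r * g a) : G.domEig y ≤ r := by
  obtain ⟨v, hv, hvM⟩ := hG.exists_left_eigenvector hy
  have h1 : v ⬝ᵥ G.distMatrix y *ᵥ g = (v ᵥ* G.distMatrix y) ⬝ᵥ g := dotProduct_mulVec ..
  rw [hvM, smul_dotProduct] at h1
  have h2 : 0 < v ⬝ᵥ g := Finset.sum_pos (fun i _ => mul_pos (hv i) (hg i)) Finset.univ_nonempty
  have h3 : v ⬝ᵥ G.distMatrix y *ᵥ g ≤ r * v ⬝ᵥ g := by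
    simp only [dotProduct, Finset.mul_sum]
    exact Finset.sum_le_sum fun a _ => by
      rw [mul_left_comm]
      exact mul_le_mul_of_nonneg_left (h a) (hv a).le
  rw [h1] at h3
  exact le_of_mul_le_mul_right h3 h2

lemma Deterministic.sum_edgeInd_le {G : LabelledGraph V} (hG : G.Deterministic) (u : V)
    (σ : Bool) : ∑ v, G.edgeInd u σ v ≤ 1 := by
  unfold edgeInd
  rw [Finset.sum_boole]
  exact_mod_cast Finset.card_le_one.2 fun v hv w hw =>
    hG u σ v w (Finset.mem_filter.1 hv).2 (Finset.mem_filter.1 hw).2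

/-- If `a` is the Perron eigenvector of the adjacency matrix, then determinism makes
`a i + a j` a supersolution for equal labels. -/
lemma Deterministic.distMatrix_zero_mulVec_le {G : LabelledGraph V} (hG : G.Deterministic)
    {a : V → ℝ} (ha : ∀ i, 0 < a i) {r : ℝ} (h : G.adjMatrix *ᵥ a = r • a) (p : V × V) :
    (G.distMatrix 0 *ᵥ fun q => a q.1 + a q.2) p ≤ r * (a p.1 + a p.2) := by
  have hA : ∀ i, ∑ σ, ∑ k, G.edgeInd i σ k * a k = r * a i := fun i => by
    have := congrFun h i
    simp only [mulVec, dotProduct, Pi.smul_apply, smul_eq_mul, adjMatrix_apply] at this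
    rw [← this, Finset.sum_comm]
    simp only [Finset.sum_mul]
  have hb : ∀ (i : V) (σ : Bool), 0 ≤ ∑ k, G.edgeInd i σ k * a k := fun i σ =>
    Finset.sum_nonneg fun k _ => mul_nonneg (G.edgeInd_nonneg ..) (ha k).le
  calc (G.distMatrix 0 *ᵥ fun q => a q.1 + a q.2) p
      = ∑ σ, ((∑ k, G.edgeInd p.1 σ k * a k) * (∑ l, G.edgeInd p.2 σ l)
          + (∑ k, G.edgeInd p.1 σ k) * (∑ l, G.edgeInd p.2 σ l * a l)) := by
        simp only [mulVec, dotProduct, distMatrix_zero_apply, Fintype.sum_prod_type,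
          Finset.sum_mul _ _ (_ + _), Finset.sum_mul_sum, ← Finset.sum_add_distrib]
        rw [Finset.sum_congr rfl fun k _ => Finset.sum_comm, Finset.sum_comm]
        refine Finset.sum_congr rfl fun σ _ => Finset.sum_congr rfl fun k _ =>
          Finset.sum_congr rfl fun l _ => ?_
        ring
    _ ≤ ∑ σ, ((∑ k, G.edgeInd p.1 σ k * a k) + (∑ l, G.edgeInd p.2 σ l * a l)) :=
        Finset.sum_le_sum fun σ _ => add_le_add
          (mul_le_of_le_one_right (hb _ _) (hG.sum_edgeInd_le _ _))
          (mul_le_of_le_one_left (hb _ _) (hG.sum_edgeInd_le _ _))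
    _ = r * (a p.1 + a p.2) := by rw [Finset.sum_add_distrib, hA, hA, mul_add]

/-- `Λ(0)` is the Perron eigenvalue of the adjacency matrix: its left eigenvector, placed on the
diagonal, is a left eigenvector of the reduced distance matrix, and `a i + a j` bounds the spectrum
from above. -/
theorem domEig_zero_eq [Nonempty V] {G : LabelledGraph V} (hdet : G.Deterministic)
    (hprim : G.Primitive) {r : ℝ} (hr : 0 < r) {a : V → ℝ} (ha : ∀ i, 0 < a i)
    (h : G.adjMatrix *ᵥ a = r • a) : G.domEig 0 = r := by
  obtain ⟨α, hα, hαM⟩ := IsPrimitive.exists_pos_left_eigenvector hprim ha h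
  set v : {p : V × V // p.1 ≤ p.2} → ℝ := fun p => if p.1.1 = p.1.2 then α p.1.1 else 0 with hv
  have hvB : v ᵥ* G.reducedDistMatrix 0 = r • v := by
    ext b
    have h1 : (v ᵥ* G.reducedDistMatrix 0) b
        = ∑ i, α i * G.reducedDistMatrix 0 ⟨(i, i), le_rfl⟩ b := by
      symm
      refine Fintype.sum_of_injective
        (fun i => (⟨(i, i), le_rfl⟩ : {p : V × V // p.1 ≤ p.2})) ?_ _ _ ?_ ?_
      · intro i j hij
        simpa using hij
      · rintro ⟨⟨i, j⟩, hij⟩ hn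
        have : i ≠ j := by
          rintro rfl
          exact hn ⟨i, rfl⟩
        simp [hv, this]
      · intro i
        simp [hv]
    rw [h1]
    by_cases hb : b.1.1 = b.1.2
    · have h2 := congrFun hαM b.1.1
      simp only [vecMul, dotProduct, Pi.smul_apply, smul_eq_mul] at h2
      simp [reducedDistMatrix, hdet.distMatrix_zero_diag, hv, hb]
      simpa [hb] using h2
    · simp [reducedDistMatrix, hdet.distMatrix_zero_diag, hv, hb, Ne.symm hb]
  obtain ⟨i⟩ := ‹Nonempty V›
  refine dominantEigenvalue_eq (G.reducedDistMatrix_nonneg le_rfl) hr.le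
    (mem_spectrum_of_vecMul_eq_smul (fun h0 => ?_) hvB) (g := fun p => a p.1.1 + a p.1.2)
    (fun p => add_pos (ha _) (ha _)) fun p => ?_
  · have := congrFun h0 ⟨(i, i), le_rfl⟩
    simp [hv, (hα i).ne'] at this
  · rw [reducedDistMatrix_mulVec G 0 (f := fun q => a q.1 + a q.2) fun q => add_comm _ _]
    exact hdet.distMatrix_zero_mulVec_le ha h p.1

theorem domEig_one_eq [Nonempty V] {G : LabelledGraph V} (hprim : G.Primitive) {r : ℝ}
    {a : V → ℝ} (ha : ∀ i, 0 < a i) (h : G.adjMatrix *ᵥ a = r • a) : G.domEig 1 = r ^ 2 := by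
  obtain ⟨v, hv, hvM⟩ := hprim.exists_left_eigenvector one_pos
  set g : V × V → ℝ := fun p => a p.1 * a p.2 with hg
  have hMg : G.distMatrix 1 *ᵥ g = r ^ 2 • g := by
    ext p
    have h1 := congrFun h p.1
    have h2 := congrFun h p.2
    simp only [mulVec, dotProduct, Pi.smul_apply, smul_eq_mul] at h1 h2
    simp only [mulVec, dotProduct, Pi.smul_apply, smul_eq_mul, distMatrix_one, hg,
      kroneckerMap_apply, Fintype.sum_prod_type]
    rw [show r ^ 2 * (a p.1 * a p.2) = (r * a p.1) * (r * a p.2) by ring, ← h1, ← h2,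
      Finset.sum_mul_sum]
    exact Finset.sum_congr rfl fun k _ => Finset.sum_congr rfl fun l _ => by ring
  have h1 : v ⬝ᵥ G.distMatrix 1 *ᵥ g = (v ᵥ* G.distMatrix 1) ⬝ᵥ g := dotProduct_mulVec ..
  have h2 : 0 < v ⬝ᵥ g :=
    Finset.sum_pos (fun i _ => mul_pos (hv i) (mul_pos (ha _) (ha _))) Finset.univ_nonempty
  rw [hvM, smul_dotProduct, hMg, dotProduct_smul] at h1
  exact (mul_right_cancel₀ h2.ne' h1).symm

lemma domEig_eq_domEig_zero {G : LabelledGraph V} (hD : G.differMatrix = 0) (y : ℝ) :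
    G.domEig y = G.domEig 0 := by
  have h : G.distMatrix y = G.distMatrix 0 := by rw [distMatrix_eq_add G y, hD, smul_zero, add_zero]
  unfold domEig reducedDistMatrix
  rw [h]

end LabelledGraph

/-! ### Convexity and differentiability of the dominant eigenvalue -/

lemma rpow_mul_rpow_le {p q X Y θ η : ℝ} (hp : 0 ≤ p) (hq : 0 ≤ q) (hX : 0 < X) (hY : 0 < Y)
    (hθ : 0 ≤ θ) (hη : 0 ≤ η) (h1 : θ + η = 1) :
    p ^ θ * q ^ η ≤ X ^ θ * Y ^ η * (θ * (p / X) + η * (q / Y)) := by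
  have h := Real.geom_mean_le_arith_mean2_weighted hθ hη (div_nonneg hp hX.le)
    (div_nonneg hq hY.le) h1
  have hXp := Real.rpow_pos_of_pos hX θ
  have hYp := Real.rpow_pos_of_pos hY η
  rw [Real.div_rpow hp hX.le, Real.div_rpow hq hY.le] at h
  calc p ^ θ * q ^ η = X ^ θ * Y ^ η * (p ^ θ / X ^ θ * (q ^ η / Y ^ η)) := by
        field_simp
    _ ≤ _ := mul_le_mul_of_nonneg_left h (mul_pos hXp hYp).le

namespace LabelledGraph

open Matrix Topology

variable {V : Type*} [Fintype V] [LinearOrder V] [Nonempty V]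

/-- The cumulant generating function `F(t) = log Λ(eᵗ)` (natural logarithm) of the distance
between the two words read along a random pair of paths. -/
noncomputable def logEig (G : LabelledGraph V) (t : ℝ) : ℝ := Real.log (G.domEig (Real.exp t))

/-- `Λ` is log-convex on a logarithmic scale: the geometric mean of the Perron eigenvectors at two
points is a supersolution at the intermediate point, by the weighted inequality between geometric
and arithmetic means. -/
theorem Primitive.convexOn_logEig {G : LabelledGraph V} (hG : G.Primitive) :
    ConvexOn ℝ univ G.logEig := by
  refine ⟨convex_univ, fun s _ t _ θ η hθ hη h1 => ?_⟩
  obtain ⟨hs, u, hu, -, hMu⟩ := hG.exists_right_eigenvector (Real.exp_pos s)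
  obtain ⟨ht, w, hw, -, hMw⟩ := hG.exists_right_eigenvector (Real.exp_pos t)
  set x := G.domEig (Real.exp s) with hx
  set z := G.domEig (Real.exp t) with hz
  have hxp := Real.rpow_pos_of_pos hs θ
  have hzp := Real.rpow_pos_of_pos ht η
  have key : G.domEig (Real.exp (θ • s + η • t)) ≤ x ^ θ * z ^ η := by
    refine hG.domEig_le (Real.exp_pos _) (g := fun a => u a ^ θ * w a ^ η)
      (fun a => mul_pos (Real.rpow_pos_of_pos (hu a) _) (Real.rpow_pos_of_pos (hw a) _))
      fun a => ?_
    have hX : 0 < x * u a := mul_pos hs (hu a)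
    have hY : 0 < z * w a := mul_pos ht (hw a)
    have hua := congrFun hMu a
    have hwa := congrFun hMw a
    simp only [mulVec, dotProduct, Pi.smul_apply, smul_eq_mul] at hua hwa ⊢
    rw [distMatrix_eq_add] at hua hwa ⊢
    simp only [Matrix.add_apply, Matrix.smul_apply, smul_eq_mul] at hua hwa ⊢
    have hexp : Real.exp (θ * s + η * t) = Real.exp s ^ θ * Real.exp t ^ η := by
      rw [← Real.exp_mul, ← Real.exp_mul, ← Real.exp_add]; ring_nf
    set K := (x * u a) ^ θ * (z * w a) ^ η with hK
    calc ∑ b, (G.distMatrix 0 a b + Real.exp (θ * s + η * t) * G.differMatrix a b)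
          * (u b ^ θ * w b ^ η)
        ≤ ∑ b, K * (θ * ((G.distMatrix 0 a b + Real.exp s * G.differMatrix a b) * u b / (x * u a))
          + η * ((G.distMatrix 0 a b + Real.exp t * G.differMatrix a b) * w b / (z * w a))) := by
          refine Finset.sum_le_sum fun b _ => ?_
          have e1 := rpow_mul_rpow_le (hu b).le (hw b).le hX hY hθ hη h1
          have e2 := rpow_mul_rpow_le (mul_pos (Real.exp_pos s) (hu b)).le
            (mul_pos (Real.exp_pos t) (hw b)).le hX hY hθ hη h1
          rw [Real.mul_rpow (Real.exp_pos s).le (hu b).le,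
            Real.mul_rpow (Real.exp_pos t).le (hw b).le] at e2
          have e3 := mul_le_mul_of_nonneg_left e1 (G.distMatrix_nonneg le_rfl a b)
          have e4 := mul_le_mul_of_nonneg_left e2 (G.differMatrix_nonneg a b)
          rw [hexp]
          calc _ = G.distMatrix 0 a b * (u b ^ θ * w b ^ η) + G.differMatrix a b *
                (Real.exp s ^ θ * u b ^ θ * (Real.exp t ^ η * w b ^ η)) := by ring
            _ ≤ _ := add_le_add e3 e4
            _ = _ := by rw [← hK]; ring
      _ = K := by
          rw [← Finset.mul_sum, Finset.sum_add_distrib, ← Finset.mul_sum, ← Finset.mul_sum,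
            ← Finset.sum_div, ← Finset.sum_div, hua, hwa, div_self hX.ne', div_self hY.ne',
            mul_one, mul_one, h1, mul_one]
      _ = x ^ θ * z ^ η * (u a ^ θ * w a ^ η) := by
          rw [hK, Real.mul_rpow hs.le (hu a).le, Real.mul_rpow ht.le (hw a).le]; ring
  have h2 := Real.log_le_log (hG.domEig_pos (Real.exp_pos _)) key
  rw [Real.log_mul hxp.ne' hzp.ne', Real.log_rpow hs, Real.log_rpow ht] at h2
  exact h2

lemma Primitive.continuousAt_domEig {G : LabelledGraph V} (hG : G.Primitive) {y : ℝ}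
    (hy : 0 < y) : ContinuousAt G.domEig y := by
  have h1 : Continuous G.logEig :=
    continuousOn_univ.1 (hG.convexOn_logEig.continuousOn isOpen_univ)
  have h2 : ContinuousAt (fun z => Real.exp (G.logEig (Real.log z))) y :=
    Real.continuous_exp.continuousAt.comp
      (h1.continuousAt.comp (Real.continuousAt_log hy.ne'))
  refine h2.congr ?_
  filter_upwards [eventually_gt_nhds hy] with z hz
  rw [logEig, Real.exp_log hz, Real.exp_log (hG.domEig_pos hz)]

/-- The normalized Perron eigenvector depends continuously on `y`: the eigenvectors lie in the
compact simplex, and each cluster point is an eigenvector at the limit, hence the Perron one. -/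
lemma Primitive.tendsto_eigenvector {G : LabelledGraph V} (hG : G.Primitive) {y : ℝ}
    (hy : 0 < y) {U : ℝ → V × V → ℝ} (hU : ∀ z, 0 < z → (∀ a, 0 < U z a) ∧ ∑ a, U z a = 1 ∧
      G.distMatrix z *ᵥ U z = G.domEig z • U z) : Tendsto U (𝓝 y) (𝓝 (U y)) := by
  have hpos := eventually_gt_nhds hy
  refine (isCompact_stdSimplex ℝ (V × V)).tendsto_nhds_of_unique_mapClusterPt ?_ ?_
  · filter_upwards [hpos] with z hz
    exact ⟨fun a => ((hU z hz).1 a).le, (hU z hz).2.1⟩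
  · intro w hw hcl
    obtain ⟨f, hf, hfw⟩ := mapClusterPt_iff_ultrafilter.1 hcl
    refine (hG.distMatrix hy).eigenvector_unique (hU y hy).1 (hU y hy).2.1 (hU y hy).2.2 hw.2 ?_
    have hid : Tendsto (fun z : ℝ => z) f (𝓝 y) := hf
    have h1 : Tendsto (fun z => G.distMatrix z *ᵥ U z) f (𝓝 (G.distMatrix y *ᵥ w)) := by
      refine tendsto_pi_nhds.2 fun a => tendsto_finsetSum _ fun b _ =>
        Tendsto.mul ?_ (tendsto_pi_nhds.1 hfw b)
      have h2 : ∀ z, G.distMatrix z a b = G.distMatrix 0 a b + z * G.differMatrix a b :=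
        fun z => congrFun (congrFun (distMatrix_eq_add G z) a) b
      have h4 : Tendsto (fun z => G.distMatrix z a b) f (𝓝 (G.distMatrix y a b)) := by
        rw [h2 y]
        refine Tendsto.congr (fun z => (h2 z).symm) ?_
        exact tendsto_const_nhds.add (hid.mul_const _)
      exact h4
    have h3 : Tendsto (fun z => G.domEig z • U z) f (𝓝 (G.domEig y • w)) :=
      ((hG.continuousAt_domEig hy).tendsto.comp hid).smul hfw
    refine tendsto_nhds_unique (h1.congr' ?_) h3
    filter_upwards [hf hpos] with z hz
    exact (hU z hz).2.2

/-- Perturbation of the Perron eigenvalue: `Λ'(y) = v D u / v u`, where `u` and `v` are the right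
and left Perron eigenvectors of the distance matrix at `y` and `D` is its derivative. -/
theorem Primitive.hasDerivAt_domEig {G : LabelledGraph V} (hG : G.Primitive) {y : ℝ}
    (hy : 0 < y) {u v : V × V → ℝ} (hu : ∀ a, 0 < u a) (hu1 : ∑ a, u a = 1)
    (hMu : G.distMatrix y *ᵥ u = G.domEig y • u) (hv : ∀ a, 0 < v a)
    (hMv : v ᵥ* G.distMatrix y = G.domEig y • v) :
    HasDerivAt G.domEig (v ⬝ᵥ G.differMatrix *ᵥ u / v ⬝ᵥ u) y := by
  choose! U hU using fun z (hz : 0 < z) => (hG.exists_right_eigenvector hz).2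
  have hUy : U y = u :=
    (hG.distMatrix hy).eigenvector_unique hu hu1 hMu (hU y hy).2.1 (hU y hy).2.2
  have hcont := hG.tendsto_eigenvector hy hU
  rw [hUy] at hcont
  have hvu : 0 < v ⬝ᵥ u := Finset.sum_pos (fun i _ => mul_pos (hv i) (hu i)) Finset.univ_nonempty
  rw [hasDerivAt_iff_tendsto_slope]
  have h1 : Tendsto (fun z => v ⬝ᵥ G.differMatrix *ᵥ U z / v ⬝ᵥ U z) (𝓝 y)
      (𝓝 (v ⬝ᵥ G.differMatrix *ᵥ u / v ⬝ᵥ u)) := by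
    have hc : ContinuousAt (fun w : V × V → ℝ => v ⬝ᵥ G.differMatrix *ᵥ w / v ⬝ᵥ w) u := by
      have c1 : Continuous fun w : V × V → ℝ => v ⬝ᵥ G.differMatrix *ᵥ w := by
        simp only [mulVec, dotProduct]; fun_prop
      have c2 : Continuous fun w : V × V → ℝ => v ⬝ᵥ w := by
        simp only [dotProduct]; fun_prop
      exact c1.continuousAt.div c2.continuousAt hvu.ne'
    exact hc.tendsto.comp hcont
  refine (h1.mono_left nhdsWithin_le_nhds).congr' ?_
  filter_upwards [nhdsWithin_le_nhds (eventually_gt_nhds hy), self_mem_nhdsWithin] with z hz hzy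
  have hvU : 0 < v ⬝ᵥ U z :=
    Finset.sum_pos (fun i _ => mul_pos (hv i) ((hU z hz).1 i)) Finset.univ_nonempty
  have hzy' : z - y ≠ 0 := sub_ne_zero.2 hzy
  have e1 : v ⬝ᵥ G.distMatrix z *ᵥ U z = G.domEig z * v ⬝ᵥ U z := by
    rw [(hU z hz).2.2, dotProduct_smul, smul_eq_mul]
  have e2 : v ⬝ᵥ G.distMatrix y *ᵥ U z = G.domEig y * v ⬝ᵥ U z := by
    rw [dotProduct_mulVec, hMv, smul_dotProduct, smul_eq_mul]
  rw [distMatrix_eq_add, add_mulVec, dotProduct_add, smul_mulVec, dotProduct_smul,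
    smul_eq_mul] at e1 e2
  rw [slope_def_field, div_eq_div_iff hvU.ne' hzy']
  linear_combination e1 - e2

/-- Bounds for the logarithmic derivative of `Λ`. Each product edge contributes degree at most one
in `y`, which gives the upper bound. -/
theorem Primitive.exists_hasDerivAt_domEig {G : LabelledGraph V} (hG : G.Primitive) {y : ℝ}
    (hy : 0 < y) : ∃ d, HasDerivAt G.domEig d y ∧ y * d ≤ G.domEig y ∧
      (G.differMatrix ≠ 0 → 0 < d) := by
  obtain ⟨-, u, hu, hu1, hMu⟩ := hG.exists_right_eigenvector hy
  obtain ⟨v, hv, hMv⟩ := hG.exists_left_eigenvector hy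
  have hvu : 0 < v ⬝ᵥ u := Finset.sum_pos (fun i _ => mul_pos (hv i) (hu i)) Finset.univ_nonempty
  refine ⟨_, hG.hasDerivAt_domEig hy hu hu1 hMu hv hMv, ?_, fun hD => div_pos ?_ hvu⟩
  · rw [← mul_div_assoc, div_le_iff₀ hvu]
    have e1 : v ⬝ᵥ G.distMatrix y *ᵥ u = G.domEig y * v ⬝ᵥ u := by
      rw [hMu, dotProduct_smul, smul_eq_mul]
    rw [distMatrix_eq_add, add_mulVec, dotProduct_add, smul_mulVec, dotProduct_smul,
      smul_eq_mul] at e1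
    have e2 : 0 ≤ v ⬝ᵥ G.distMatrix 0 *ᵥ u :=
      Finset.sum_nonneg fun a _ => mul_nonneg (hv a).le <| Finset.sum_nonneg fun b _ =>
        mul_nonneg (G.distMatrix_nonneg le_rfl a b) (hu b).le
    linarith
  · obtain ⟨a, ha⟩ := Function.ne_iff.1 hD
    obtain ⟨b, hb⟩ := Function.ne_iff.1 ha
    have hb' : 0 < G.differMatrix a b :=
      lt_of_le_of_ne (G.differMatrix_nonneg a b) (Ne.symm hb)
    have hn : ∀ a b, 0 ≤ G.differMatrix a b * u b := fun a b =>
      mul_nonneg (G.differMatrix_nonneg a b) (hu b).le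
    exact Finset.sum_pos' (fun a _ => mul_nonneg (hv a).le (Finset.sum_nonneg fun b _ => hn a b))
      ⟨a, Finset.mem_univ _, mul_pos (hv a) (Finset.sum_pos' (fun b _ => hn a b)
        ⟨b, Finset.mem_univ _, mul_pos hb' (hu b)⟩)⟩

lemma Primitive.domEig_zero_le {G : LabelledGraph V} (hG : G.Primitive) (hdet : G.Deterministic)
    {y : ℝ} (hy : 0 < y) : G.domEig 0 ≤ G.domEig y := by
  obtain ⟨r, hr, a, ha, -, hMa⟩ := IsPrimitive.exists_pos_eigenvector hG
  obtain ⟨α, hα, hMα⟩ := IsPrimitive.exists_pos_left_eigenvector hG ha hMa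
  obtain ⟨-, u, hu, -, hMu⟩ := hG.exists_right_eigenvector hy
  rw [domEig_zero_eq hdet hG hr ha hMa]
  set d : V → ℝ := fun i => u (i, i) with hd
  have hαd : 0 < α ⬝ᵥ d := Finset.sum_pos (fun i _ => mul_pos (hα i) (hu _)) Finset.univ_nonempty
  have h1 : ∀ i, (G.adjMatrix *ᵥ d) i ≤ G.domEig y * d i := fun i => by
    have h2 : (G.adjMatrix *ᵥ d) i = (G.distMatrix 0 *ᵥ u) (i, i) := by
      simp only [mulVec, dotProduct, Fintype.sum_prod_type, hdet.distMatrix_zero_diag, ite_mul,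
        zero_mul, Finset.sum_ite_eq, Finset.mem_univ, if_true, hd]
    have h3 := congrFun hMu (i, i)
    rw [distMatrix_eq_add, add_mulVec, smul_mulVec] at h3
    simp only [Pi.add_apply, Pi.smul_apply, smul_eq_mul] at h3
    have h4 : 0 ≤ (G.differMatrix *ᵥ u) (i, i) :=
      Finset.sum_nonneg fun b _ => mul_nonneg (G.differMatrix_nonneg _ b) (hu b).le
    rw [h2, hd, ← h3]
    exact le_add_of_nonneg_right (mul_nonneg hy.le h4)
  have h5 : α ⬝ᵥ G.adjMatrix *ᵥ d = r * α ⬝ᵥ d := by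
    rw [dotProduct_mulVec, hMα, smul_dotProduct, smul_eq_mul]
  have h6 : α ⬝ᵥ G.adjMatrix *ᵥ d ≤ G.domEig y * α ⬝ᵥ d := by
    simp only [dotProduct, Finset.mul_sum]
    exact Finset.sum_le_sum fun i _ => by
      rw [mul_left_comm]
      exact mul_le_mul_of_nonneg_left (h1 i) (hα i).le
  rw [h5] at h6
  exact le_of_mul_le_mul_right h6 hαd

lemma Primitive.hasDerivAt_logEig {G : LabelledGraph V} (hG : G.Primitive) (t : ℝ) :
    HasDerivAt G.logEig (G.deltaFun (Real.exp t)) t := by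
  obtain ⟨d, hd, -⟩ := hG.exists_hasDerivAt_domEig (Real.exp_pos t)
  have h := (hd.comp t (Real.hasDerivAt_exp t)).log (hG.domEig_pos (Real.exp_pos t)).ne'
  rw [deltaFun, hd.deriv, mul_comm (Real.exp t)]
  exact h

lemma Primitive.deltaFun_le_one {G : LabelledGraph V} (hG : G.Primitive) {y : ℝ} (hy : 0 < y) :
    G.deltaFun y ≤ 1 := by
  obtain ⟨d, hd, h, -⟩ := hG.exists_hasDerivAt_domEig hy
  rw [deltaFun, hd.deriv]
  exact (div_le_one (hG.domEig_pos hy)).2 h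

lemma Primitive.deltaFun_pos {G : LabelledGraph V} (hG : G.Primitive) (hD : G.differMatrix ≠ 0)
    {y : ℝ} (hy : 0 < y) : 0 < G.deltaFun y := by
  obtain ⟨d, hd, -, h⟩ := hG.exists_hasDerivAt_domEig hy
  rw [deltaFun, hd.deriv]
  exact div_pos (mul_pos hy (h hD)) (hG.domEig_pos hy)

end LabelledGraph

/-! ### Counting pairs of words by their distance -/

lemma hammingDist_cons {n : ℕ} (σ τ : Bool) (x z : Fin n → Bool) :
    hammingDist (Fin.cons σ x : Fin (n + 1) → Bool) (Fin.cons τ z)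
      = LabelledGraph.labelDist σ τ + hammingDist x z := by
  simp only [hammingDist, Finset.card_filter, Fin.sum_univ_succ, Fin.cons_zero, Fin.cons_succ,
    LabelledGraph.labelDist, ne_eq, ite_not]

lemma sum_fin_succ_bool {n : ℕ} (f : (Fin (n + 1) → Bool) → ℝ) :
    ∑ x, f x = ∑ σ, ∑ x : Fin n → Bool, f (Fin.cons σ x) := by
  rw [← (Fin.consEquiv fun _ : Fin (n + 1) => Bool).sum_comp, Fintype.sum_prod_type]
  rfl

namespace LabelledGraph

open Matrix

section

variable {V : Type*} [Fintype V] [LinearOrder V]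

/-- The number of paths that start in the state `i` and read the word `x`. -/
noncomputable def pathCount (G : LabelledGraph V) : {n : ℕ} → V → (Fin n → Bool) → ℝ
  | 0, _, _ => 1
  | _ + 1, i, x => ∑ k, G.edgeInd i (x 0) k * pathCount G k (Fin.tail x)

lemma pathCount_cons (G : LabelledGraph V) {n : ℕ} (i : V) (σ : Bool) (x : Fin n → Bool) :
    G.pathCount i (Fin.cons σ x : Fin (n + 1) → Bool) = ∑ k, G.edgeInd i σ k * G.pathCount k x := by
  rw [pathCount, Fin.cons_zero, Fin.tail_cons]

lemma pathCount_nonneg (G : LabelledGraph V) {n : ℕ} (i : V) (x : Fin n → Bool) :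
    0 ≤ G.pathCount i x := by
  induction n generalizing i with
  | zero => exact zero_le_one
  | succ n ih => exact Finset.sum_nonneg fun k _ => mul_nonneg (G.edgeInd_nonneg ..) (ih k _)

lemma Deterministic.pathCount_le_one {G : LabelledGraph V} (hG : G.Deterministic) {n : ℕ} (i : V)
    (x : Fin n → Bool) : G.pathCount i x ≤ 1 := by
  induction n generalizing i with
  | zero => exact le_rfl
  | succ n ih =>
    refine le_trans (Finset.sum_le_sum fun k _ => ?_) (hG.sum_edgeInd_le i (x 0))
    exact mul_le_of_le_one_right (G.edgeInd_nonneg ..) (ih k _)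

lemma one_le_pathCount (G : LabelledGraph V) {n : ℕ} {x : Fin n → Bool} {p : Fin (n + 1) → V}
    (hp : ∀ t : Fin n, (p t.castSucc, x t, p t.succ) ∈ G.edges) : 1 ≤ G.pathCount (p 0) x := by
  induction n with
  | zero => exact le_rfl
  | succ n ih =>
    have h1 : 1 ≤ G.pathCount (p 1) (Fin.tail x) :=
      ih (p := Fin.tail p) fun t => hp t.succ
    have h2 : G.edgeInd (p 0) (x 0) (p 1) = 1 := if_pos (hp 0)
    rw [pathCount]
    refine le_trans ?_ (Finset.single_le_sum (fun k _ => mul_nonneg (G.edgeInd_nonneg ..)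
      (G.pathCount_nonneg k _)) (Finset.mem_univ (p 1)))
    rwa [h2, one_mul]

lemma exists_path_of_pathCount_ne_zero (G : LabelledGraph V) {n : ℕ} {i : V} {x : Fin n → Bool}
    (h : G.pathCount i x ≠ 0) : ∃ p : Fin (n + 1) → V, p 0 = i ∧
      ∀ t : Fin n, (p t.castSucc, x t, p t.succ) ∈ G.edges := by
  induction n generalizing i with
  | zero => exact ⟨fun _ => i, rfl, fun t => t.elim0⟩
  | succ n ih =>
    obtain ⟨k, -, hk⟩ := Finset.exists_ne_zero_of_sum_ne_zero h
    obtain ⟨h1, h2⟩ := mul_ne_zero_iff.1 hk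
    obtain ⟨p, hp0, hp⟩ := ih h2
    refine ⟨Fin.cons i p, rfl, fun t => ?_⟩
    refine Fin.cases ?_ (fun t => ?_) t
    · have h3 : (i, x 0, k) ∈ G.edges := by
        by_contra hn
        exact h1 (if_neg hn)
      simpa [hp0] using h3
    · simpa [Fin.tail] using hp t

lemma pathCount_eq_zero (G : LabelledGraph V) {n : ℕ} (i : V) {x : Fin n → Bool}
    (hx : x ∉ G.words n) : G.pathCount i x = 0 := by
  classical
  by_contra h
  obtain ⟨p, -, hp⟩ := G.exists_path_of_pathCount_ne_zero h
  exact hx (Finset.mem_filter.2 ⟨Finset.mem_univ x, p, hp⟩)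

lemma one_le_sum_pathCount (G : LabelledGraph V) {n : ℕ} {x : Fin n → Bool}
    (hx : x ∈ G.words n) : 1 ≤ ∑ i, G.pathCount i x := by
  classical
  obtain ⟨p, hp⟩ := (Finset.mem_filter.1 hx).2
  exact (G.one_le_pathCount hp).trans
    (Finset.single_le_sum (fun k _ => G.pathCount_nonneg k x) (Finset.mem_univ (p 0)))

lemma sum_pathCount (G : LabelledGraph V) (n : ℕ) (i : V) :
    ∑ x : Fin n → Bool, G.pathCount i x = (G.adjMatrix ^ n *ᵥ 1) i := by
  induction n generalizing i with
  | zero => simp [pathCount]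
  | succ n ih =>
    rw [sum_fin_succ_bool, pow_succ', ← mulVec_mulVec]
    simp only [pathCount_cons, mulVec, dotProduct] at ih ⊢
    simp only [← ih, adjMatrix_apply, Finset.sum_mul]
    rw [Finset.sum_comm (s := (Finset.univ : Finset V))]
    refine Finset.sum_congr rfl fun σ _ => ?_
    rw [Finset.sum_comm]
    simp only [Finset.mul_sum]

/-- The powers of the distance matrix count pairs of paths by the distance of their words. -/
lemma sum_pathCount_mul_pow (G : LabelledGraph V) (y : ℝ) (n : ℕ) (a : V × V) :
    ∑ x : Fin n → Bool, ∑ z : Fin n → Bool,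
        G.pathCount a.1 x * G.pathCount a.2 z * y ^ hammingDist x z
      = (G.distMatrix y ^ n *ᵥ 1) a := by
  induction n generalizing a with
  | zero => simp [pathCount]
  | succ n ih =>
    have h1 : (G.distMatrix y ^ (n + 1) *ᵥ 1) a
        = ∑ b : V × V, ∑ σ, ∑ τ, ∑ x : Fin n → Bool, ∑ z : Fin n → Bool,
          (G.edgeInd a.1 σ b.1 * G.edgeInd a.2 τ b.2 * y ^ labelDist σ τ) *
            (G.pathCount b.1 x * G.pathCount b.2 z * y ^ hammingDist x z) := by
      rw [pow_succ', ← mulVec_mulVec, mulVec, dotProduct]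
      refine Finset.sum_congr rfl fun b _ => ?_
      rw [← ih b, distMatrix_apply]
      simp only [Finset.sum_mul]
      simp only [Finset.mul_sum]
    have h2 : ∀ σ τ, ∀ x z : Fin n → Bool,
        G.pathCount a.1 (Fin.cons σ x : Fin (n + 1) → Bool)
          * G.pathCount a.2 (Fin.cons τ z : Fin (n + 1) → Bool)
          * y ^ hammingDist (Fin.cons σ x : Fin (n + 1) → Bool) (Fin.cons τ z)
        = ∑ b : V × V, (G.edgeInd a.1 σ b.1 * G.edgeInd a.2 τ b.2 * y ^ labelDist σ τ) *
            (G.pathCount b.1 x * G.pathCount b.2 z * y ^ hammingDist x z) := by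
      intro σ τ x z
      rw [pathCount_cons, pathCount_cons, hammingDist_cons, Finset.sum_mul_sum, Finset.sum_mul,
        Fintype.sum_prod_type]
      refine Finset.sum_congr rfl fun k _ => ?_
      rw [Finset.sum_mul]
      refine Finset.sum_congr rfl fun l _ => ?_
      rw [pow_add]; ring
    rw [h1, sum_fin_succ_bool]
    simp only [sum_fin_succ_bool (n := n), h2]
    symm
    rw [Finset.sum_comm]
    refine Finset.sum_congr rfl fun σ _ => ?_
    rw [Finset.sum_congr rfl fun b _ => Finset.sum_comm, Finset.sum_comm]
    refine Finset.sum_congr rfl fun x _ => ?_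
    rw [Finset.sum_comm]
    exact Finset.sum_congr rfl fun τ _ => Finset.sum_comm

end

section Growth

variable {V : Type*} [Fintype V] [LinearOrder V] [Nonempty V]

/-- Each word is read along at least one and at most `|V|` paths, so the number of words grows
like the number of paths. -/
theorem exists_card_words_bounds {G : LabelledGraph V} (hdet : G.Deterministic)
    (hprim : G.Primitive) : ∃ a > 0, ∃ b > 0, ∀ n : ℕ,
      a * G.domEig 0 ^ n ≤ ((G.words n).card : ℝ) ∧
        ((G.words n).card : ℝ) ≤ b * G.domEig 0 ^ n := by
  obtain ⟨r, hr, u, hu, -, hMu⟩ := IsPrimitive.exists_pos_eigenvector hprim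
  obtain ⟨c, hc, C, hC, h⟩ := exists_rowSum_pow_bounds hprim.nonneg hr hu hMu
  rw [domEig_zero_eq hdet hprim hr hu hMu]
  have hcard : (0 : ℝ) < Fintype.card V := by exact_mod_cast Fintype.card_pos
  refine ⟨c, hc, Fintype.card V * C, mul_pos hcard hC, fun n => ⟨?_, ?_⟩⟩
  · obtain ⟨i⟩ := ‹Nonempty V›
    refine (h n i).1.trans ?_
    rw [← sum_pathCount, ← Finset.sum_subset (Finset.subset_univ (G.words n))
      fun x _ hx => G.pathCount_eq_zero i hx]
    simpa using Finset.sum_le_sum fun x (_ : x ∈ G.words n) => hdet.pathCount_le_one i x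
  · calc ((G.words n).card : ℝ) = ∑ x ∈ G.words n, 1 := by simp
      _ ≤ ∑ x ∈ G.words n, ∑ i, G.pathCount i x :=
          Finset.sum_le_sum fun x hx => G.one_le_sum_pathCount hx
      _ ≤ ∑ x, ∑ i, G.pathCount i x := Finset.sum_le_sum_of_subset_of_nonneg
          (Finset.subset_univ _) fun x _ _ => Finset.sum_nonneg fun i _ => G.pathCount_nonneg i x
      _ = ∑ i, (G.adjMatrix ^ n *ᵥ 1) i := by
          rw [Finset.sum_comm]; simp only [sum_pathCount]
      _ ≤ ∑ _i : V, C * r ^ n := Finset.sum_le_sum fun i _ => (h n i).2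
      _ = Fintype.card V * C * r ^ n := by
          rw [Finset.sum_const, nsmul_eq_mul, Finset.card_univ, mul_assoc]

/-- The distance enumerator of `S_n` grows like `Λ(y) ^ n`. -/
theorem exists_distEnumerator_bounds {G : LabelledGraph V} (hdet : G.Deterministic)
    (hprim : G.Primitive) {y : ℝ} (hy : 0 < y) : ∃ a > 0, ∃ b > 0, ∀ n : ℕ,
      a * G.domEig y ^ n ≤ ∑ x ∈ G.words n, ∑ z ∈ G.words n, y ^ hammingDist x z ∧
        ∑ x ∈ G.words n, ∑ z ∈ G.words n, y ^ hammingDist x z ≤ b * G.domEig y ^ n := by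
  obtain ⟨hr, u, hu, -, hMu⟩ := hprim.exists_right_eigenvector hy
  obtain ⟨c, hc, C, hC, h⟩ := exists_rowSum_pow_bounds (hprim.distMatrix hy).nonneg hr hu hMu
  set r := G.domEig y
  have hcard : (0 : ℝ) < Fintype.card (V × V) := by exact_mod_cast Fintype.card_pos
  have hsum : ∀ (n : ℕ) (a : V × V), (G.distMatrix y ^ n *ᵥ 1) a
      = ∑ x ∈ G.words n, ∑ z ∈ G.words n,
          G.pathCount a.1 x * G.pathCount a.2 z * y ^ hammingDist x z := by
    intro n a
    rw [← sum_pathCount_mul_pow, ← Finset.sum_subset (Finset.subset_univ (G.words n))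
      fun x _ hx => by simp [G.pathCount_eq_zero a.1 hx]]
    exact Finset.sum_congr rfl fun x _ => (Finset.sum_subset (Finset.subset_univ _)
      fun z _ hz => by simp [G.pathCount_eq_zero a.2 hz]).symm
  refine ⟨c, hc, Fintype.card (V × V) * C, mul_pos hcard hC, fun n => ⟨?_, ?_⟩⟩
  · obtain ⟨i⟩ := ‹Nonempty V›
    refine (h n (i, i)).1.trans ?_
    rw [hsum]
    refine Finset.sum_le_sum fun x _ => Finset.sum_le_sum fun z _ =>
      mul_le_of_le_one_left (pow_nonneg hy.le _) ?_
    exact mul_le_one₀ (hdet.pathCount_le_one _ _) (G.pathCount_nonneg _ _)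
      (hdet.pathCount_le_one _ _)
  · calc ∑ x ∈ G.words n, ∑ z ∈ G.words n, y ^ hammingDist x z
        ≤ ∑ x ∈ G.words n, ∑ z ∈ G.words n, ∑ a : V × V,
          G.pathCount a.1 x * G.pathCount a.2 z * y ^ hammingDist x z := by
          refine Finset.sum_le_sum fun x hx => Finset.sum_le_sum fun z hz => ?_
          have hprod : ∑ a : V × V, G.pathCount a.1 x * G.pathCount a.2 z
              = (∑ i, G.pathCount i x) * ∑ j, G.pathCount j z := by
            rw [Finset.sum_mul_sum, Fintype.sum_prod_type]
          rw [← Finset.sum_mul, hprod]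
          refine le_mul_of_one_le_left (pow_nonneg hy.le _) ?_
          exact one_le_mul_of_one_le_of_one_le (G.one_le_sum_pathCount hx)
            (G.one_le_sum_pathCount hz)
      _ = ∑ a, (G.distMatrix y ^ n *ᵥ 1) a := by
          simp only [hsum]
          rw [Finset.sum_comm (s := Finset.univ)]
          exact Finset.sum_congr rfl fun x _ => Finset.sum_comm
      _ ≤ ∑ _a : V × V, C * r ^ n := Finset.sum_le_sum fun a _ => (h n a).2
      _ = Fintype.card (V × V) * C * r ^ n := by
          rw [Finset.sum_const, nsmul_eq_mul, Finset.card_univ, mul_assoc]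

end Growth

section

variable {V : Type*}

/-- The number of ordered pairs of words of `S_n` at Hamming distance `m`. -/
noncomputable def distCount (G : LabelledGraph V) (n m : ℕ) : ℕ :=
  ∑ x ∈ G.words n, ((G.words n).filter fun z => hammingDist x z = m).card

lemma totalBallSize_eq (G : LabelledGraph V) (n d : ℕ) :
    G.totalBallSize n d = ∑ m ∈ Finset.range (d - 1 + 1), G.distCount n m := by
  unfold totalBallSize distCount ballVolume
  rw [Finset.sum_comm]
  refine Finset.sum_congr rfl fun x _ => ?_
  rw [Finset.card_eq_sum_card_fiberwise (f := fun z => hammingDist x z)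
    (t := Finset.range (d - 1 + 1))]
  · refine Finset.sum_congr rfl fun m hm => ?_
    rw [Finset.filter_filter]
    congr 1
    ext z
    simp only [Finset.mem_filter, Finset.mem_range] at hm ⊢
    constructor
    · exact fun h => ⟨h.1, h.2.2⟩
    · exact fun h => ⟨h.1, by omega, h.2⟩
  · intro z hz
    simp only [Finset.coe_filter, mem_ofPred_eq] at hz
    simp only [Finset.coe_range, mem_Iio]
    omega

lemma sum_distCount_mul_pow (G : LabelledGraph V) (n : ℕ) (y : ℝ) :
    ∑ m ∈ Finset.range (n + 1), (G.distCount n m : ℝ) * y ^ m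
      = ∑ x ∈ G.words n, ∑ z ∈ G.words n, y ^ hammingDist x z := by
  unfold distCount
  simp only [Nat.cast_sum, Finset.sum_mul]
  rw [Finset.sum_comm]
  refine Finset.sum_congr rfl fun x _ => ?_
  have hmaps : ∀ z ∈ G.words n, hammingDist x z ∈ Finset.range (n + 1) := fun z _ => by
    have := hammingDist_le_card_fintype (x := x) (y := z)
    rw [Fintype.card_fin] at this
    exact Finset.mem_range.2 (by omega)
  rw [← Finset.sum_fiberwise_of_maps_to hmaps]
  refine Finset.sum_congr rfl fun m _ => ?_
  rw [← nsmul_eq_mul, ← Finset.sum_const]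
  exact Finset.sum_congr rfl fun z hz => by rw [(Finset.mem_filter.1 hz).2]

lemma totalBallSize_zero (G : LabelledGraph V) (n : ℕ) :
    G.totalBallSize n 0 = (G.words n).card := by
  unfold totalBallSize ballVolume
  rw [Finset.card_eq_sum_ones]
  refine Finset.sum_congr rfl fun x hx => ?_
  rw [Finset.card_eq_one]
  refine ⟨x, ?_⟩
  ext z
  simp only [Finset.mem_filter, Nat.zero_sub, nonpos_iff_eq_zero, hammingDist_eq_zero,
    Finset.mem_singleton]
  constructor
  · exact fun h => h.2.symm
  · rintro rfl
    exact ⟨hx, rfl⟩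

end

end LabelledGraph

/-! ### Large deviations of a sequence of counts -/

section LargeDeviations

open Topology

/-- A sequence that is `exp (n (L + o(1)))` has the base two growth rate `L / log 2`. -/
lemma tendsto_logb_div_of_exp_bounds {P : ℕ → ℝ} {L : ℝ}
    (hlow : ∀ ε > 0, ∀ᶠ n : ℕ in atTop, Real.exp (n * (L - ε)) ≤ P n)
    (hup : ∀ ε > 0, ∀ᶠ n : ℕ in atTop, P n ≤ Real.exp (n * (L + ε))) :
    Tendsto (fun n : ℕ => Real.logb 2 (P n) / n) atTop (𝓝 (L / Real.log 2)) := by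
  have h : Tendsto (fun n : ℕ => Real.log (P n) / n) atTop (𝓝 L) := by
    rw [Metric.tendsto_nhds]
    intro ε hε
    filter_upwards [hlow (ε / 2) (half_pos hε), hup (ε / 2) (half_pos hε),
      eventually_gt_atTop 0] with n h1 h2 hn
    have hn' : (0 : ℝ) < n := Nat.cast_pos.2 hn
    have hP : 0 < P n := (Real.exp_pos _).trans_le h1
    have h3 := (Real.le_log_iff_exp_le hP).2 h1
    have h4 := (Real.log_le_iff_le_exp hP).2 h2
    have h5 : L - ε / 2 ≤ Real.log (P n) / n := by rw [le_div_iff₀ hn']; linarith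
    have h6 : Real.log (P n) / n ≤ L + ε / 2 := by rw [div_le_iff₀ hn']; linarith
    rw [Real.dist_eq, abs_lt]
    constructor <;> linarith
  refine (h.div_const (Real.log 2)).congr fun n => ?_
  rw [Real.logb, div_right_comm]

lemma eventually_mul_le_exp (K : ℝ) {ε : ℝ} (hε : 0 < ε) :
    ∀ᶠ n : ℕ in atTop, K * (n + 1) ≤ Real.exp (n * ε) := by
  have h2 : Tendsto (fun n : ℕ => (n : ℝ) * ε) atTop atTop :=
    tendsto_natCast_atTop_atTop.atTop_mul_const hε
  have h3 := (Real.tendsto_exp_div_pow_atTop 1).comp h2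
  filter_upwards [h3.eventually_ge_atTop (2 * |K| / ε), eventually_gt_atTop 0] with n hn hn0
  have hn' : (1 : ℝ) ≤ n := by exact_mod_cast hn0
  simp only [Function.comp, pow_one] at hn
  rw [div_le_div_iff₀ hε (by positivity)] at hn
  have h4 : 2 * |K| * n ≤ Real.exp (n * ε) := by
    refine le_of_mul_le_mul_right ?_ hε
    linarith
  have h5 := le_abs_self K
  have h6 := abs_nonneg K
  nlinarith

/-- A family of counts `c n d`, `d ≤ n`, whose exponential moments `∑ d, c n d * exp (t d)` are of
the order `exp (n F(t))` for every `t`. -/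
def HasCumulantRate (c : ℕ → ℕ → ℕ) (F : ℝ → ℝ) : Prop :=
  ∀ t, ∃ a > 0, ∃ b > 0, ∀ n : ℕ,
    a * Real.exp (n * F t) ≤ ∑ d ∈ Finset.range (n + 1), (c n d : ℝ) * Real.exp (t * d) ∧
    ∑ d ∈ Finset.range (n + 1), (c n d : ℝ) * Real.exp (t * d) ≤ b * Real.exp (n * F t)

variable {c : ℕ → ℕ → ℕ} {F : ℝ → ℝ}

/-- Chernoff's bound. -/
lemma HasCumulantRate.eventually_le (h : HasCumulantRate c F) {t δ : ℝ} (ht : t ≤ 0) (hδ1 : δ ≤ 1)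
    (hδ : 0 ≤ δ) {ε : ℝ} (hε : 0 < ε) : ∀ᶠ n : ℕ in atTop,
      ((∑ m ∈ Finset.range (⌊δ * n⌋₊ - 1 + 1), c n m : ℕ) : ℝ)
        ≤ Real.exp (n * (F t - t * δ + ε)) := by
  obtain ⟨a, ha, b, hb, hab⟩ := h t
  filter_upwards [eventually_mul_le_exp b hε] with n hn
  set m := ⌊δ * n⌋₊ - 1 with hm
  have hfl : (⌊δ * n⌋₊ : ℝ) ≤ δ * n := Nat.floor_le (by positivity)
  have hm1 : (m : ℝ) ≤ δ * n := le_trans (by exact_mod_cast Nat.sub_le _ _) hfl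
  have hmn : m ≤ n := by
    have : (m : ℝ) ≤ n := hm1.trans (mul_le_of_le_one_left (Nat.cast_nonneg n) hδ1)
    exact_mod_cast this
  have h1 : ((∑ d ∈ Finset.range (m + 1), c n d : ℕ) : ℝ) * Real.exp (t * (δ * n))
      ≤ b * Real.exp (n * F t) := by
    refine le_trans ?_ (hab n).2
    push_cast
    rw [Finset.sum_mul]
    refine le_trans (Finset.sum_le_sum fun d hd => ?_)
      (Finset.sum_le_sum_of_subset_of_nonneg (Finset.range_mono (Nat.succ_le_succ hmn))
        fun d _ _ => mul_nonneg (Nat.cast_nonneg _) (Real.exp_pos _).le)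
    refine mul_le_mul_of_nonneg_left (Real.exp_le_exp.2 ?_) (Nat.cast_nonneg _)
    have hd' : (d : ℝ) ≤ m := by exact_mod_cast Nat.lt_succ_iff.1 (Finset.mem_range.1 hd)
    exact mul_le_mul_of_nonpos_left (hd'.trans hm1) ht
  have h2 : b ≤ Real.exp (n * ε) := le_trans (le_mul_of_one_le_right hb.le (by
    have : (0 : ℝ) ≤ n := Nat.cast_nonneg n
    linarith)) hn
  rw [← le_div_iff₀ (Real.exp_pos _)] at h1
  refine h1.trans ?_
  rw [div_le_iff₀ (Real.exp_pos _), ← Real.exp_add]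
  calc b * Real.exp (n * F t) ≤ Real.exp (n * ε) * Real.exp (n * F t) :=
        mul_le_mul_of_nonneg_right h2 (Real.exp_pos _).le
    _ = _ := by rw [← Real.exp_add]; ring_nf

/-- The largest term of the exponential moment at `t` sits at a distance `d ≈ n F'(t)`: comparing
the moments at `t` and at a nearby `s` bounds `(s - t) d` by `n (F(s) - F(t)) + o(n)`. Hence the
number of terms up to `δ n` is at least that single term, if `δ > F'(t)`. -/
lemma HasCumulantRate.eventually_ge (h : HasCumulantRate c F) {t δ' δ : ℝ} (ht : t ≤ 0)
    (hF : HasDerivAt F δ' t) (hδ : δ' < δ) {ε : ℝ} (hε : 0 < ε) : ∀ᶠ n : ℕ in atTop,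
      Real.exp (n * (F t - t * δ' - ε))
        ≤ ((∑ m ∈ Finset.range (⌊δ * n⌋₊ - 1 + 1), c n m : ℕ) : ℝ) := by
  -- The location `d / n` of the largest term will be known up to `2 η`: small enough to stay below
  -- `δ - η`, and to change the exponent `-t d / n` by at most `ε / 2`.
  obtain ⟨η, hη, hη1, hη2⟩ : ∃ η > 0, η ≤ (δ - δ') / 3 ∧ 2 * η * -t ≤ ε / 2 := by
    refine ⟨min ((δ - δ') / 3) (ε / (4 * (-t + 1))), lt_min (by linarith) ?_, min_le_left _ _, ?_⟩
    · exact div_pos hε (by linarith)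
    · have h1 : 0 < 4 * (-t + 1) := by linarith
      have h2 := (le_div_iff₀ h1).1 (min_le_right ((δ - δ') / 3) (ε / (4 * (-t + 1))))
      have h3 : 0 ≤ min ((δ - δ') / 3) (ε / (4 * (-t + 1))) :=
        le_min (by linarith) (div_pos hε h1).le
      nlinarith
  have hlin := hF.isLittleO.def hη
  obtain ⟨ρ, hρ, hball⟩ := Metric.eventually_nhds_iff.1 hlin
  obtain ⟨a, ha, b, hb, hab⟩ := h t
  -- The largest term at `t`, compared with the moment at `s`.
  have hcompare : ∀ s, s ≠ t → |s - t| < ρ → ∀ᶠ n : ℕ in atTop, ∀ d ∈ Finset.range (n + 1),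
      a / (n + 1) * Real.exp (n * F t) ≤ c n d * Real.exp (t * d) →
        (s - t) * d ≤ n * ((s - t) * δ' + 2 * η * |s - t|) := by
    intro s hs hsρ
    have hst : 0 < |s - t| := abs_pos.2 (sub_ne_zero.2 hs)
    obtain ⟨a', ha', b', hb', hab'⟩ := h s
    have hη' : 0 < η * |s - t| := mul_pos hη hst
    filter_upwards [eventually_mul_le_exp (b' / a) hη'] with n hn d hd hmax
    have hn1 : (0 : ℝ) < n + 1 := by positivity
    have hslope : F s - F t - (s - t) * δ' ≤ η * |s - t| := by
      have h1 := hball (y := s) (by rwa [Real.dist_eq])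
      simp only [smul_eq_mul, Real.norm_eq_abs] at h1
      exact (le_abs_self _).trans h1
    have h1 : (c n d : ℝ) * Real.exp (s * d) ≤ b' * Real.exp (n * F s) :=
      (Finset.single_le_sum (f := fun d => (c n d : ℝ) * Real.exp (s * d))
        (fun d _ => mul_nonneg (Nat.cast_nonneg _) (Real.exp_pos _).le) hd).trans (hab' n).2
    have h2 : a / (n + 1) * Real.exp (n * F t) * Real.exp ((s - t) * d)
        ≤ b' * Real.exp (n * F s) := by
      refine le_trans (mul_le_mul_of_nonneg_right hmax (Real.exp_pos _).le) (le_trans ?_ h1)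
      rw [mul_assoc, ← Real.exp_add]
      exact le_of_eq (by ring_nf)
    have h3 : Real.exp (n * F t) * Real.exp ((s - t) * d)
        ≤ Real.exp (n * (η * |s - t|)) * Real.exp (n * F s) := by
      calc Real.exp (n * F t) * Real.exp ((s - t) * d)
          = (n + 1) / a * (a / (n + 1) * Real.exp (n * F t) * Real.exp ((s - t) * d)) := by
            field_simp
        _ ≤ (n + 1) / a * (b' * Real.exp (n * F s)) :=
            mul_le_mul_of_nonneg_left h2 (div_pos hn1 ha).le
        _ = b' / a * (n + 1) * Real.exp (n * F s) := by ring
        _ ≤ _ := mul_le_mul_of_nonneg_right hn (Real.exp_pos _).le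
    rw [← Real.exp_add, ← Real.exp_add, Real.exp_le_exp] at h3
    have h4 := mul_le_mul_of_nonneg_left hslope (Nat.cast_nonneg n)
    linarith
  have hρ2 : |ρ / 2| < ρ := by rw [abs_of_pos (half_pos hρ)]; linarith
  have hup := hcompare (t + ρ / 2) (by linarith) (by simpa using hρ2)
  have hdown := hcompare (t - ρ / 2) (by linarith) (by simpa using hρ2)
  -- Only distances up to `⌊δ n⌋ - 1` count: the slack `n η ≥ 2` absorbs the rounding and the shift.
  have hbig : ∀ᶠ n : ℕ in atTop, 2 ≤ (n : ℝ) * η :=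
    (tendsto_natCast_atTop_atTop.atTop_mul_const hη).eventually_ge_atTop 2
  filter_upwards [hup, hdown, hbig, eventually_mul_le_exp (1 / a) (half_pos hε)]
    with n hup hdown hbig hexp
  have hn1 : (0 : ℝ) < n + 1 := by positivity
  obtain ⟨d, hd, hmax⟩ : ∃ d ∈ Finset.range (n + 1),
      a / (n + 1) * Real.exp (n * F t) ≤ c n d * Real.exp (t * d) := by
    refine Finset.exists_le_of_sum_le (by simp) ?_
    refine le_trans (le_of_eq ?_) (hab n).1
    rw [Finset.sum_const, Finset.card_range, nsmul_eq_mul]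
    push_cast
    field_simp
  have h1 := hup d hd hmax
  have h2 := hdown d hd hmax
  rw [add_sub_cancel_left, abs_of_pos (half_pos hρ)] at h1
  rw [sub_sub_cancel_left, abs_neg, abs_of_pos (half_pos hρ)] at h2
  have hdu : (d : ℝ) ≤ n * (δ' + 2 * η) := by
    refine le_of_mul_le_mul_left ?_ (half_pos hρ); linarith
  have hdl : n * (δ' - 2 * η) ≤ (d : ℝ) := by
    refine le_of_mul_le_mul_left ?_ (half_pos hρ); linarith
  have hn0 : (0 : ℝ) ≤ n := Nat.cast_nonneg n
  have hdm : d ≤ ⌊δ * n⌋₊ - 1 := by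
    have h3 : ((d + 1 : ℕ) : ℝ) ≤ δ * n := by
      have : n * (δ' + 3 * η) ≤ n * δ := mul_le_mul_of_nonneg_left (by linarith) hn0
      push_cast
      linarith
    have := Nat.le_floor h3
    omega
  have h4 : (c n d : ℝ) ≤ ((∑ m ∈ Finset.range (⌊δ * n⌋₊ - 1 + 1), c n m : ℕ) : ℝ) := by
    exact_mod_cast Finset.single_le_sum (f := fun m => c n m) (fun _ _ => Nat.zero_le _)
      (Finset.mem_range.2 (Nat.lt_succ_of_le hdm))
  refine le_trans ?_ h4
  have h5 : a * Real.exp (n * F t) * Real.exp (-(t * d)) ≤ c n d * (n + 1) := by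
    have h6 := mul_le_mul_of_nonneg_right hmax (Real.exp_pos (-(t * d))).le
    rw [mul_assoc (c n d : ℝ), ← Real.exp_add, add_neg_cancel, Real.exp_zero, mul_one] at h6
    calc a * Real.exp (n * F t) * Real.exp (-(t * d))
        = (a / (n + 1) * Real.exp (n * F t) * Real.exp (-(t * d))) * (n + 1) := by field_simp
      _ ≤ _ := mul_le_mul_of_nonneg_right h6 hn1.le
  have h7 : (n + 1 : ℝ) ≤ a * Real.exp (n * (ε / 2)) := by
    rw [one_div, inv_mul_le_iff₀ ha] at hexp
    exact hexp
  have h8 : n * (F t - t * δ' - ε) + n * (ε / 2) ≤ n * F t + -(t * d) := by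
    have h9 := mul_le_mul_of_nonneg_left hdl (neg_nonneg.2 ht)
    have h10 := mul_le_mul_of_nonneg_left hη2 hn0
    linarith
  refine le_of_mul_le_mul_right ?_ hn1
  calc Real.exp (n * (F t - t * δ' - ε)) * (n + 1)
      ≤ Real.exp (n * (F t - t * δ' - ε)) * (a * Real.exp (n * (ε / 2))) :=
        mul_le_mul_of_nonneg_left h7 (Real.exp_pos _).le
    _ = a * Real.exp (n * (F t - t * δ' - ε) + n * (ε / 2)) := by rw [Real.exp_add]; ring
    _ ≤ a * Real.exp (n * F t + -(t * d)) :=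
        mul_le_mul_of_nonneg_left (Real.exp_le_exp.2 h8) ha.le
    _ = a * Real.exp (n * F t) * Real.exp (-(t * d)) := by rw [Real.exp_add]; ring
    _ ≤ _ := h5

/-- A differentiable function that is bounded below has arbitrarily small derivatives far left. -/
lemma exists_lt_deriv_lt {f : ℝ → ℝ} (hF : ∀ t, HasDerivAt F (f t) t) {B : ℝ} (hB : ∀ t, B ≤ F t)
    (t : ℝ) {κ : ℝ} (hκ : 0 < κ) : ∃ s < t, f s < κ := by
  set N := (F t - B) / κ + 1 with hN
  have hNpos : 0 < N := by
    have := div_nonneg (sub_nonneg.2 (hB t)) hκ.le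
    linarith
  obtain ⟨s, hs, hfs⟩ := exists_hasDerivAt_eq_slope F f (show t - N < t by linarith)
    (fun x _ => (hF x).continuousAt.continuousWithinAt) fun x _ => hF x
  refine ⟨s, hs.2, ?_⟩
  rw [hfs, div_lt_iff₀ (by linarith)]
  have h1 := hB (t - N)
  have h2 : κ * ((F t - B) / κ) = F t - B := mul_div_cancel₀ _ hκ.ne'
  rw [sub_sub_cancel, hN, mul_add, h2]
  linarith

lemma exists_deriv_eq {f : ℝ → ℝ} (hF : ∀ t, HasDerivAt F (f t) t) {s t m : ℝ} (hst : s < t)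
    (hs : f s < m) (ht : m < f t) : ∃ x, s < x ∧ x < t ∧ f x = m := by
  obtain ⟨x, hx, hfx⟩ := exists_hasDerivWithinAt_eq_of_gt_of_lt hst.le
    (fun x _ => (hF x).hasDerivWithinAt) hs ht
  exact ⟨x, hx.1, hx.2, hfx⟩

/-- A one-dimensional Gärtner-Ellis theorem for lower tails: the number of terms up to distance
`δ n`, where `δ = F'(t)`, grows with the Legendre transform of `F` at `δ` as its rate. The lower
bound is applied at points `x < t` with `F'(x) < δ` arbitrarily close to `δ`; the tangent inequality
of the convex function `F` controls the loss. -/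
theorem HasCumulantRate.tendsto_rate (h : HasCumulantRate c F) {f : ℝ → ℝ}
    (hF : ∀ t, HasDerivAt F (f t) t) (hconv : ConvexOn ℝ univ F) {B : ℝ} (hB : ∀ t, B ≤ F t)
    {t : ℝ} (ht : t ≤ 0) (hδ : 0 < f t) (hδ1 : f t ≤ 1) :
    Tendsto (fun n : ℕ => Real.logb 2
      ((∑ m ∈ Finset.range (⌊f t * n⌋₊ - 1 + 1), c n m : ℕ) : ℝ) / n) atTop
      (𝓝 ((F t - t * f t) / Real.log 2)) := by
  refine tendsto_logb_div_of_exp_bounds (fun ε hε => ?_)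
    fun ε hε => h.eventually_le ht hδ1 hδ.le hε
  obtain ⟨s, hst, hfs⟩ := exists_lt_deriv_lt hF hB t hδ
  have hs0 : 0 < -s := by linarith
  obtain ⟨κ, hκ, hκ1, hκ2⟩ : ∃ κ > 0, κ < f t - f s ∧ κ * -s ≤ ε / 2 := by
    refine ⟨min ((f t - f s) / 2) (ε / 2 / -s), lt_min (by linarith)
      (div_pos (half_pos hε) hs0), ?_, ?_⟩
    · exact lt_of_le_of_lt (min_le_left _ _) (by linarith)
    · exact (le_div_iff₀ hs0).1 (min_le_right _ _)
  obtain ⟨x, hsx, hxt, hfx⟩ := exists_deriv_eq hF hst (show f s < f t - κ by linarith)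
    (by linarith)
  filter_upwards [h.eventually_ge (ε := ε / 2) (hxt.le.trans ht) (hF x)
    (show f x < f t by linarith) (half_pos hε)] with n hn
  refine le_trans (Real.exp_le_exp.2 (mul_le_mul_of_nonneg_left ?_ (Nat.cast_nonneg n))) hn
  have htan : F t - F x ≤ f t * (t - x) := by
    have h1 := hconv.slope_le_of_hasDerivAt (mem_univ x) (mem_univ t) hxt (hF t)
    rw [slope_def_field, div_le_iff₀ (by linarith)] at h1
    exact h1
  have h2 : κ * -x ≤ κ * -s := mul_le_mul_of_nonneg_left (by linarith) hκ.le
  rw [hfx]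
  linarith

/-- Beyond the typical distance `F'(0)`, the counts have the full growth rate `F(0)`. -/
theorem HasCumulantRate.tendsto_rate_of_lt (h : HasCumulantRate c F) {δ' δ : ℝ}
    (hF : HasDerivAt F δ' 0) (hδ' : δ' < δ) (hδ : 0 ≤ δ) (hδ1 : δ ≤ 1) :
    Tendsto (fun n : ℕ => Real.logb 2
      ((∑ m ∈ Finset.range (⌊δ * n⌋₊ - 1 + 1), c n m : ℕ) : ℝ) / n) atTop
      (𝓝 (F 0 / Real.log 2)) :=
  tendsto_logb_div_of_exp_bounds
    (fun ε hε => by simpa using h.eventually_ge le_rfl hF hδ' hε)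
    fun ε hε => by simpa using h.eventually_le le_rfl hδ1 hδ hε

end LargeDeviations

/-! ### The Gilbert-Varshamov curve -/

namespace LabelledGraph

open Matrix Topology

lemma deltaFun_zero {V : Type*} [Fintype V] [LinearOrder V] {G : LabelledGraph V} :
    G.deltaFun 0 = 0 := by simp [deltaFun]

lemma gvRate_zero {V : Type*} {G : LabelledGraph V} :
    G.gvRate 0 = G.capacity := by
  have h : G.ballRate 0 = G.capacity := by
    unfold ballRate capacity
    simp only [zero_mul, Nat.floor_zero, totalBallSize_zero]
  rw [gvRate, h]
  ring

variable {V : Type*} [Fintype V] [LinearOrder V] [Nonempty V] {G : LabelledGraph V}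

lemma domEig_zero_pos (hdet : G.Deterministic) (hprim : G.Primitive) : 0 < G.domEig 0 := by
  obtain ⟨r, hr, a, ha, -, hMa⟩ := IsPrimitive.exists_pos_eigenvector hprim
  rwa [domEig_zero_eq hdet hprim hr ha hMa]

lemma domEig_one_eq_sq (hdet : G.Deterministic) (hprim : G.Primitive) :
    G.domEig 1 = G.domEig 0 ^ 2 := by
  obtain ⟨r, hr, a, ha, -, hMa⟩ := IsPrimitive.exists_pos_eigenvector hprim
  rw [domEig_zero_eq hdet hprim hr ha hMa, domEig_one_eq hprim ha hMa]

lemma logEig_zero (hdet : G.Deterministic) (hprim : G.Primitive) :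
    G.logEig 0 = 2 * Real.log (G.domEig 0) := by
  rw [logEig, Real.exp_zero, domEig_one_eq_sq hdet hprim, Real.log_pow]
  norm_num

lemma capacity_eq (hdet : G.Deterministic) (hprim : G.Primitive) :
    G.capacity = Real.logb 2 (G.domEig 0) := by
  obtain ⟨a, ha, b, hb, h⟩ := exists_card_words_bounds hdet hprim
  have hpow : ∀ n : ℕ, G.domEig 0 ^ n = Real.exp (n * Real.log (G.domEig 0)) := fun n => by
    rw [Real.exp_nat_mul, Real.exp_log (domEig_zero_pos hdet hprim)]
  refine (tendsto_logb_div_of_exp_bounds (fun ε hε => ?_) fun ε hε => ?_).limsup_eq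
  · filter_upwards [eventually_mul_le_exp (1 / a) hε] with n hn
    have h1 : (1 : ℝ) ≤ a * Real.exp (n * ε) := by
      rw [one_div, inv_mul_le_iff₀ ha] at hn
      refine le_trans ?_ hn
      exact le_add_of_nonneg_left (Nat.cast_nonneg n)
    refine le_trans ?_ (h n).1
    rw [hpow]
    calc Real.exp (n * (Real.log (G.domEig 0) - ε))
        ≤ Real.exp (n * (Real.log (G.domEig 0) - ε)) * (a * Real.exp (n * ε)) :=
          le_mul_of_one_le_right (Real.exp_pos _).le h1
      _ = a * Real.exp (n * (Real.log (G.domEig 0) - ε) + n * ε) := by rw [Real.exp_add]; ring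
      _ = _ := by ring_nf
  · filter_upwards [eventually_mul_le_exp b hε] with n hn
    have h1 : b ≤ Real.exp (n * ε) := le_trans (le_mul_of_one_le_right hb.le
      (le_add_of_nonneg_left (Nat.cast_nonneg n))) hn
    refine (h n).2.trans ?_
    rw [hpow, mul_add, Real.exp_add, mul_comm (Real.exp _)]
    exact mul_le_mul_of_nonneg_right h1 (Real.exp_pos _).le

lemma hasCumulantRate_distCount (hdet : G.Deterministic) (hprim : G.Primitive) :
    HasCumulantRate G.distCount G.logEig := by
  intro t
  obtain ⟨a, ha, b, hb, h⟩ := exists_distEnumerator_bounds hdet hprim (Real.exp_pos t)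
  refine ⟨a, ha, b, hb, fun n => ?_⟩
  have h1 : Real.exp (n * G.logEig t) = G.domEig (Real.exp t) ^ n := by
    rw [Real.exp_nat_mul, logEig, Real.exp_log (hprim.domEig_pos (Real.exp_pos t))]
  have h2 : ∀ d : ℕ, Real.exp (t * d) = Real.exp t ^ d := fun d => by
    rw [mul_comm, Real.exp_nat_mul]
  simp only [h1, h2, sum_distCount_mul_pow]
  exact h n

lemma log_domEig_zero_le_logEig (hdet : G.Deterministic) (hprim : G.Primitive) (t : ℝ) :
    Real.log (G.domEig 0) ≤ G.logEig t :=
  Real.log_le_log (domEig_zero_pos hdet hprim) (hprim.domEig_zero_le hdet (Real.exp_pos t))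

lemma rhoGV_zero (hdet : G.Deterministic) (hprim : G.Primitive) : G.rhoGV 0 = G.capacity := by
  rw [rhoGV, deltaFun_zero, capacity_eq hdet hprim]
  ring

lemma rhoGV_one (hdet : G.Deterministic) (hprim : G.Primitive) : G.rhoGV 1 = 0 := by
  rw [rhoGV, capacity_eq hdet hprim, domEig_one_eq_sq hdet hprim, Real.logb_pow, Real.logb_one]
  push_cast
  ring

/-- If all product edges carry equal labels then `Λ` is constant, and `Λ(1) = Λ(0) ^ 2` forces
`Λ = 1`. -/
lemma degenerate_of_differMatrix_eq_zero (hdet : G.Deterministic) (hprim : G.Primitive)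
    (hD : G.differMatrix = 0) : G.capacity = 0 ∧ ∀ y, G.deltaFun y = 0 ∧ G.rhoGV y = 0 := by
  have h1 : G.domEig 0 = 1 := by
    have h2 := domEig_one_eq_sq hdet hprim
    rw [domEig_eq_domEig_zero hD 1] at h2
    have h3 := domEig_zero_pos hdet hprim
    nlinarith
  have h2 : G.domEig = fun _ => 1 := funext fun y => by rw [domEig_eq_domEig_zero hD, h1]
  have h3 : G.capacity = 0 := by rw [capacity_eq hdet hprim, h1, Real.logb_one]
  have h4 : ∀ y, G.deltaFun y = 0 := fun y => by simp [deltaFun, h2]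
  exact ⟨h3, fun y => ⟨h4 y, by simp [rhoGV, h3, h4, h2]⟩⟩

/-- The parametrization lies on the Gilbert-Varshamov curve. -/
lemma gvRate_deltaFun (hdet : G.Deterministic) (hprim : G.Primitive) {y : ℝ} (hy : y ∈ Icc 0 1) :
    G.gvRate (G.deltaFun y) = G.rhoGV y := by
  rcases hy.1.eq_or_lt with rfl | hy0
  · rw [deltaFun_zero, gvRate_zero, rhoGV_zero hdet hprim]
  by_cases hD : G.differMatrix = 0
  · obtain ⟨h1, h2⟩ := degenerate_of_differMatrix_eq_zero hdet hprim hD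
    rw [(h2 y).1, (h2 y).2, gvRate_zero, h1]
  have h := (hasCumulantRate_distCount hdet hprim).tendsto_rate hprim.hasDerivAt_logEig
    hprim.convexOn_logEig (log_domEig_zero_le_logEig hdet hprim) (t := Real.log y)
    (Real.log_nonpos hy0.le hy.2)
  simp only [Real.exp_log hy0, ← totalBallSize_eq] at h
  have h1 : G.ballRate (G.deltaFun y) = _ :=
    (h (hprim.deltaFun_pos hD hy0) (hprim.deltaFun_le_one hy0)).limsup_eq
  rw [gvRate, h1, rhoGV, logEig, Real.exp_log hy0, Real.logb, Real.logb]
  ring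

lemma gvRate_eq_zero (hdet : G.Deterministic) (hprim : G.Primitive) {δ : ℝ} (hδ0 : 0 ≤ δ)
    (hδ : G.deltaMax ≤ δ) (hδ1 : δ ≤ 1) : G.gvRate δ = 0 := by
  rcases hδ.eq_or_lt with rfl | hlt
  · exact (gvRate_deltaFun hdet hprim ⟨zero_le_one, le_rfl⟩).trans (rhoGV_one hdet hprim)
  have h0 := hprim.hasDerivAt_logEig 0
  rw [Real.exp_zero] at h0
  have h := (hasCumulantRate_distCount hdet hprim).tendsto_rate_of_lt h0 hlt hδ0 hδ1
  simp only [← totalBallSize_eq] at h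
  have h1 : G.ballRate δ = _ := h.limsup_eq
  rw [gvRate, h1, logEig_zero hdet hprim, capacity_eq hdet hprim, Real.logb]
  ring

lemma exists_deltaFun_eq (hdet : G.Deterministic) (hprim : G.Primitive) {δ : ℝ} (hδ0 : 0 ≤ δ)
    (hδ : δ < G.deltaMax) : ∃ y ∈ Icc (0 : ℝ) 1, G.deltaFun y = δ := by
  rcases hδ0.eq_or_lt with rfl | hpos
  · exact ⟨0, ⟨le_rfl, zero_le_one⟩, deltaFun_zero⟩
  obtain ⟨s, hs, hfs⟩ := exists_lt_deriv_lt hprim.hasDerivAt_logEig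
    (log_domEig_zero_le_logEig hdet hprim) 0 hpos
  obtain ⟨x, -, hx, hfx⟩ := exists_deriv_eq hprim.hasDerivAt_logEig hs hfs
    (by rwa [Real.exp_zero])
  exact ⟨Real.exp x, ⟨(Real.exp_pos x).le, Real.exp_le_one_iff.2 hx.le⟩, hfx⟩

lemma deltaFun_mem_Icc (hdet : G.Deterministic) (hprim : G.Primitive) {y : ℝ} (hy : 0 ≤ y) :
    G.deltaFun y ∈ Icc (0 : ℝ) 1 := by
  rcases hy.eq_or_lt with rfl | hy0
  · rw [deltaFun_zero]; exact ⟨le_rfl, zero_le_one⟩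
  refine ⟨?_, hprim.deltaFun_le_one hy0⟩
  by_cases hD : G.differMatrix = 0
  · exact ((degenerate_of_differMatrix_eq_zero hdet hprim hD).2 y).1.ge
  · exact (hprim.deltaFun_pos hD hy0).le

end LabelledGraph

theorem theorem1 {V : Type*} [Fintype V] [LinearOrder V] [Nonempty V]
    (G : LabelledGraph V) (hdet : G.Deterministic) (hprim : G.Primitive) :
    (∀ y ∈ Set.Icc (0 : ℝ) 1, 0 < G.domEig y) ∧
    (∀ y ∈ Set.Ioc (0 : ℝ) 1, DifferentiableAt ℝ G.domEig y) ∧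
    G.gvCurve =
      (fun y : ℝ => (G.deltaFun y, G.rhoGV y)) '' Set.Icc 0 1 ∪
        {p : ℝ × ℝ | G.deltaMax ≤ p.1 ∧ p.1 ≤ 1 ∧ p.2 = 0} := by
  refine ⟨fun y hy => ?_, fun y hy => ?_, ?_⟩
  · rcases hy.1.eq_or_lt with rfl | hy0
    · exact LabelledGraph.domEig_zero_pos hdet hprim
    · exact hprim.domEig_pos hy0
  · obtain ⟨d, hd, -⟩ := hprim.exists_hasDerivAt_domEig hy.1
    exact hd.differentiableAt
  · have hmax : 0 ≤ G.deltaMax := (LabelledGraph.deltaFun_mem_Icc hdet hprim zero_le_one).1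
    apply Subset.antisymm
    · rintro _ ⟨δ, hδ, rfl⟩
      rcases lt_or_ge δ G.deltaMax with hlt | hge
      · obtain ⟨y, hy, rfl⟩ := LabelledGraph.exists_deltaFun_eq hdet hprim hδ.1 hlt
        exact Or.inl ⟨y, hy, Prod.ext rfl (LabelledGraph.gvRate_deltaFun hdet hprim hy).symm⟩
      · exact Or.inr ⟨hge, hδ.2, LabelledGraph.gvRate_eq_zero hdet hprim hδ.1 hge hδ.2⟩
    · rintro p (⟨y, hy, rfl⟩ | ⟨h1, h2, h3⟩)
      · exact ⟨G.deltaFun y, LabelledGraph.deltaFun_mem_Icc hdet hprim hy.1,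
          Prod.ext rfl (LabelledGraph.gvRate_deltaFun hdet hprim hy)⟩
      · exact ⟨p.1, ⟨hmax.trans h1, h2⟩, Prod.ext rfl
          ((LabelledGraph.gvRate_eq_zero hdet hprim (hmax.trans h1) h1 h2).trans h3.symm)⟩
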